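/- Let $(\mathcal X,d)$ be a nonempty, locally compact, separable metric space with a Radon measure $\mu$ that is volume doubling: there is $C>0$ with $\mu(B(x,2r))\le C\,\mu(B(x,r))$ for all $x\in\mathcal X$, $r>0$, where $B(x,r)=\{y: d(x,y)<r\}$. Let $T\in(0,\infty]$ and let $\{\varphi_t\}_{0<t<T}$ be a heat kernel on $\mathcal X$, that is, non-negative measurable functions $\varphi_t(x,y)$ on $\mathcal X\times\mathcal X$, not necessarily symmetric, such that for all $x,y\in\mathcal X$ and $s,t>0$ with $s+t<T$: $\int_{\mathcal X}\varphi_t(x,z)\,d\mu(z)=1$; $\ \varphi_{s+t}(x,y)=\int_{\mathcal X}\varphi_s(x,z)\varphi_t(z,y)\,d\mu(z)$; and, for every $f\in L^2(\mu)$, $S_tf\to f$ in $L^2(\mu)$ as $t\to0^+$, where $S_tf(x)=\int_{\mathcal X}\varphi_t(x,y)f(y)\,d\mu(y)$. For $R>0$ and real-valued $f$ put $$H^*_Rf(x)=\sup_{0<t<R}|S_tf(x)|,\qquad \mathcal M_Rf(x)=\sup_{0<r<R}\frac1{\mu(B(x,r))}\int_{B(x,r)}|f|\,d\mu ,$$ with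 $|S_tf(x)|:=\infty$ in the definition of $H^*_R f$ if the integral defining $S_tf(x)$ does not converge absolutely. Assume that: (i) for every continuous compactly supported $f$ and every $x\in\mathcal X$, $\lim_{t\to0^+}S_tf(x)=f(x)$; (ii) there is $\eta\in(0,1]$ such that for all $R\in(0,T)$ and $x_1,x_2\in\mathcal X$ there is a constant $C=C(R,x_1,x_2)$ with $\varphi_{\eta R}(x_1,y)\le C\,\varphi_R(x_2,y)$ for all $y\in\mathcal X$; moreover, for all $R\in(0,T)$ and $x\in\mathcal X$ there is $C=C(x,R)>0$ with $\varphi_R(x,y)\ge C$ for all $y\in B(x,R)$; (iii) there are $\gamma\ge1$, functions $\xi_1,\xi_2:\mathcal X\times(0,\infty)\to(1,\infty)$ with $\xi_i(\cdot,t)$ bounded on bounded sets for each $t>0$, and $\Gamma:(0,\infty)\to(0,\infty)$, such that for all $R\in(0,T/\gamma)$, all measurable $f\ge0$ and all $x\in\mathcal X$, $$H^*_Rf(x)\le\xi_1(x,R)\,\mathcal M_{\Gamma(R)}f(x)+\xi_2(x,R)\int_{\mathcal X}\varphi_{\gamma R}(x,y)f(y)\,d\mu(y).$$ A weight is a measurable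 function $v:\mathcal X\to(0,\infty)$ for which $v\,d\mu$ is a Radon measure, and $L^p_v=L^p(v\,d\mu)$. Let $1\le p<\infty$, $\frac1p+\frac1{p'}=1$, and let $v$ be a weight. Then the following statements are equivalent: (1) There are $R\in(0,T)$ and a weight $u$ such that $H^*_R$ is bounded from $L^p_v$ into $L^p_u$ if $p>1$, and from $L^1_v$ into weak $L^1_u$ if $p=1$. (If $H^*_Rf$ is not measurable, its $L^p_u$ norm is understood as the infimum of the norms of its measurable majorants, and the measure of a level set as its outer measure.) (2) There is $R\in(0,T)$ such that for every $f\in L^p_v$ the integral $\int_{\mathcal X}\varphi_R(x,y)f(y)\,d\mu(y)$ converges absolutely for every $x\in\mathcal X$, and for $\mu$-almost every $x$ the integral $S_tf(x)$ converges absolutely for all sufficiently small $t>0$ and $\lim_{t\to0^+}S_tf(x)=f(x)$. (3) There is $R\in(0,T)$ such that for every $f\in L^p_v$ the integral $\int_{\mathcal X}\varphi_R(x,y)f(y)\,d\mu(y)$ converges absolutely for some $x\in\mathcal X$. (4) $v\in D_p$, that is, there are $t_0\in(0,T)$ and $x\in\mathcal X$ with $\big\|v^{-1/p}\varphi_{t_0}(x,\cdot)\big\|_{L^{p'}(\mu)}<\infty$.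 -/

import Mathlib

open MeasureTheory Filter Topology Set
open scoped ENNReal NNReal

noncomputable section

namespace HeatKernel

variable {X : Type*} [MetricSpace X] [MeasurableSpace X]

/-- Volume doubling: `μ (B(x, 2r)) ≤ C μ (B(x, r))` for all `x` and all `r > 0`. -/
def IsDoubling (μ : Measure X) : Prop :=
  ∃ C : ℝ≥0, ∀ (x : X) (r : ℝ), 0 < r →
    μ (Metric.ball x (2 * r)) ≤ C * μ (Metric.ball x r)

/-- The measure `v dμ`. -/
def weighted (μ : Measure X) (v : X → ℝ) : Measure X :=
  μ.withDensity fun x => ENNReal.ofReal (v x)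

/-- A weight: a strictly positive measurable function `v` for which `v dμ` is a Radon measure. -/
structure IsWeight (μ : Measure X) (v : X → ℝ) : Prop where
  pos : ∀ x, 0 < v x
  measurable : Measurable v
  radon : (weighted μ v).Regular

/-- `t` belongs to the time interval `(0, T)`, where `T` may be `∞`. -/
def IsTime (T : ℝ≥0∞) (t : ℝ) : Prop := 0 < t ∧ ENNReal.ofReal t < T

/-- The integral `∫ φ_t(x, y) f(y) dμ(y)` converges absolutely. -/
def Converges (μ : Measure X) (φ : ℝ → X → X → ℝ≥0) (t : ℝ) (f : X → ℝ) (x : X) : Prop :=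
  Integrable (fun y => (φ t x y : ℝ) * f y) μ

/-- `S_t f(x) = ∫ φ_t(x, y) f(y) dμ(y)` (meaningful where the integral converges). -/
def S (μ : Measure X) (φ : ℝ → X → X → ℝ≥0) (t : ℝ) (f : X → ℝ) (x : X) : ℝ :=
  ∫ y, (φ t x y : ℝ) * f y ∂μ

/-- A (not necessarily symmetric) heat kernel on the time interval `(0, T)`. -/
structure IsHeatKernel (μ : Measure X) (T : ℝ≥0∞) (φ : ℝ → X → X → ℝ≥0) : Prop where
  measurable : ∀ t, IsTime T t → Measurable (Function.uncurry (φ t))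
  conservative : ∀ t, IsTime T t → ∀ x, ∫⁻ y, (φ t x y : ℝ≥0∞) ∂μ = 1
  semigroup : ∀ s t, 0 < s → 0 < t → IsTime T (s + t) → ∀ x y,
    (φ (s + t) x y : ℝ≥0∞) = ∫⁻ z, (φ s x z : ℝ≥0∞) * (φ t z y : ℝ≥0∞) ∂μ
  identity_approx : ∀ f : X → ℝ, MemLp f 2 μ →
    (∀ᶠ t in 𝓝[>] (0 : ℝ), ∀ᵐ x ∂μ, Converges μ φ t f x) ∧
      Tendsto (fun t => eLpNorm (fun x => S μ φ t f x - f x) 2 μ) (𝓝[>] 0) (𝓝 0)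

open Classical in
/-- The local (time) maximal operator `H*_R f(x) = sup_{0 < t < R} |S_t f(x)|`, with values in
`[0, ∞]`; where the integral does not converge absolutely, `|S_t f(x)|` is taken to be `∞`
(for measurable `f ≥ 0` this is its true value). -/
def timeMax (μ : Measure X) (φ : ℝ → X → X → ℝ≥0) (R : ℝ) (f : X → ℝ) (x : X) : ℝ≥0∞ :=
  ⨆ t ∈ Ioo (0 : ℝ) R, if Converges μ φ t f x then ‖S μ φ t f x‖ₑ else ∞

/-- The local (centred) Hardy–Littlewood maximal function. -/
def localMax (μ : Measure X) (R : ℝ) (f : X → ℝ) (x : X) : ℝ≥0∞ :=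
  ⨆ r ∈ Ioo (0 : ℝ) R, (∫⁻ y in Metric.ball x r, ‖f y‖ₑ ∂μ) / μ (Metric.ball x r)

/-- A function on `X × (0, ∞)` with values in `(1, ∞)`, bounded on bounded subsets of `X` for
each fixed time. -/
def IsLocBddFactor (ξ : X → ℝ → ℝ) : Prop :=
  ∀ t, 0 < t → (∀ x, 1 < ξ x t) ∧
    ∀ B : Set X, Bornology.IsBounded B → ∃ M : ℝ, ∀ x ∈ B, ξ x t ≤ M

/-- The structural assumptions on the heat kernel. -/
structure KernelAssumption (μ : Measure X) (T : ℝ≥0∞) (φ : ℝ → X → X → ℝ≥0) : Prop where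
  /-- Vague convergence: `S_t f → f` pointwise for every `f ∈ C_c(X)`. -/
  vague : ∀ f : X → ℝ, Continuous f → HasCompactSupport f →
    ∀ x, Tendsto (fun t => S μ φ t f x) (𝓝[>] 0) (𝓝 (f x))
  /-- Parabolic Harnack comparison. -/
  harnack : ∃ η : ℝ, 0 < η ∧ η ≤ 1 ∧ ∀ R, IsTime T R → ∀ x₁ x₂ : X, ∃ C : ℝ≥0, ∀ y,
    φ (η * R) x₁ y ≤ C * φ R x₂ y
  /-- Positive lower bound on balls of radius `R` at time `R`. -/
  lower : ∀ R, IsTime T R → ∀ x : X, ∃ C : ℝ≥0, 0 < C ∧ ∀ y ∈ Metric.ball x R, C ≤ φ R x y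
  /-- Time-space maximal inequality. -/
  maximal : ∃ (γ : ℝ) (ξ₁ ξ₂ : X → ℝ → ℝ) (Γ : ℝ → ℝ), 1 ≤ γ ∧
    IsLocBddFactor ξ₁ ∧ IsLocBddFactor ξ₂ ∧ (∀ t, 0 < t → 0 < Γ t) ∧
    ∀ R, IsTime T (γ * R) → ∀ f : X → ℝ, Measurable f → (∀ y, 0 ≤ f y) → ∀ x,
      timeMax μ φ R f x ≤ ENNReal.ofReal (ξ₁ x R) * localMax μ (Γ R) f x +
        ENNReal.ofReal (ξ₂ x R) * ∫⁻ y, (φ (γ * R) x y : ℝ≥0∞) * ENNReal.ofReal (f y) ∂μ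

/-- The `L^q(ν)` norm of a `[0, ∞]`-valued function, computed with the upper integral: the
infimum of the norms of its measurable majorants. It is the usual norm on measurable functions.
(A supremum over uncountably many times need not be measurable.) -/
def upperLpNorm (F : X → ℝ≥0∞) (q : ℝ≥0∞) (ν : Measure X) : ℝ≥0∞ :=
  ⨅ (g : X → ℝ≥0∞) (_ : Measurable g) (_ : ∀ x, F x ≤ g x), eLpNorm g q ν

/-- `H*_R` is bounded from `L^p_v` into `L^p_u`. -/
def StrongBounded (μ : Measure X) (φ : ℝ → X → X → ℝ≥0) (p R : ℝ) (v u : X → ℝ) : Prop :=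
  ∃ C : ℝ≥0, ∀ f : X → ℝ, MemLp f (ENNReal.ofReal p) (weighted μ v) →
    upperLpNorm (timeMax μ φ R f) (ENNReal.ofReal p) (weighted μ u) ≤
      C * eLpNorm f (ENNReal.ofReal p) (weighted μ v)

/-- `H*_R` is bounded from `L^1_v` into weak `L^1_u`. -/
def WeakBounded (μ : Measure X) (φ : ℝ → X → X → ℝ≥0) (R : ℝ) (v u : X → ℝ) : Prop :=
  ∃ C : ℝ≥0, ∀ f : X → ℝ, MemLp f 1 (weighted μ v) → ∀ l : ℝ≥0, 0 < l →
    l * weighted μ u {x | (l : ℝ≥0∞) < timeMax μ φ R f x} ≤ C * eLpNorm f 1 (weighted μ v)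

/-- The weight class `D_p`: for some `t₀ ∈ (0, T)` and some `x`, the function
`v^{-1/p} φ_{t₀}(x, ·)` has finite `L^{p'}(μ)` norm, `1/p + 1/p' = 1`. -/
def InD (μ : Measure X) (T : ℝ≥0∞) (φ : ℝ → X → X → ℝ≥0) (p : ℝ) (v : X → ℝ) : Prop :=
  ∃ t₀, IsTime T t₀ ∧ ∃ x : X,
    eLpNorm (fun y => v y ^ (-(1 / p)) * (φ t₀ x y : ℝ))
      (ENNReal.conjExponent (ENNReal.ofReal p)) μ < ∞

end HeatKernel

end

noncomputable section

namespace HeatKernel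

/-! ### Balls in a doubling space -/

section Geometry

variable {X : Type*} [MetricSpace X] [MeasurableSpace X] {μ : Measure X}

/-! The cycle is (1) ⇒ (2) ⇒ (3) ⇒ (4) ⇒ (1), with (2) ⇒ (3) immediate.

(1) ⇒ (2): approximate `f` in `L^p_v` by continuous compactly supported `g n` with error `2⁻ⁿ`. The
weak type bound and Borel–Cantelli make the maximal function of `f - g n` small at almost every
point, and vague convergence handles `g n` (`tendsto_S_of_approx`, `ae_tendsto_of_bounded`). Harnack
then carries absolute convergence from one good point to every point, at an earlier time.

(3) ⇒ (4): Harnack replaces the point depending on `f` by a fixed `x₀`, so `v^{-1/p} φ(x₀, ·)` has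
finite pairing with all of `L^p(μ)`. A condensation argument makes the bound uniform, and duality
puts this function in `L^{p'}(μ)` (`inD_of_forall_exists_converges`).

(4) ⇒ (1): in the time-space maximal inequality, Hölder and (4) bound the kernel integral by a dual
norm times the norm of `f`. What remains is the local maximal function. The kernel lower bound gives
`v^{-1/p} ∈ L^{p'}` on balls. For `p = 1` this makes `f` integrable on balls and the weak `(1,1)`
inequality suffices (`exists_weakBounded`). For `p > 1`, `σ = v^{-1/(p-1)}` is locally integrable,
so its maximal function is finite almost everywhere. Where that function is bounded, Marcinkiewicz
interpolation applies to `G ↦ M(Gσ)`, and `f = Gσ` is the right substitution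
(`exists_strongBounded`). All constants depend only on a measurable integer level of the point, and
`u` is chosen level by level to absorb them. -/

theorem IsDoubling.pow_two_mul (h : IsDoubling μ) (k : ℕ) :
    ∃ A : ℝ≥0, ∀ (x : X) (r : ℝ), 0 < r →
      μ (Metric.ball x (2 ^ k * r)) ≤ A * μ (Metric.ball x r) := by
  obtain ⟨C, hC⟩ := h
  refine ⟨C ^ k, fun x r hr => ?_⟩
  induction k with
  | zero => simp
  | succ k ih =>
    calc μ (Metric.ball x (2 ^ (k + 1) * r)) = μ (Metric.ball x (2 * (2 ^ k * r))) := by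
          rw [pow_succ]; ring_nf
      _ ≤ C * μ (Metric.ball x (2 ^ k * r)) := hC _ _ (by positivity)
      _ ≤ C * ((C ^ k : ℝ≥0) * μ (Metric.ball x r)) := by gcongr
      _ = _ := by push_cast; rw [pow_succ]; ring

theorem exists_le_two_pow_mul {ε : ℝ} (hε : 0 < ε) (r : ℝ) : ∃ k : ℕ, r ≤ 2 ^ k * ε := by
  obtain ⟨k, hk⟩ := pow_unbounded_of_one_lt (r / ε) (one_lt_two (α := ℝ))
  exact ⟨k, by rw [div_lt_iff₀ hε] at hk; exact hk.le⟩

theorem IsDoubling.ball_lt_top [LocallyCompactSpace X] [IsFiniteMeasureOnCompacts μ]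
    (h : IsDoubling μ) (x : X) (r : ℝ) : μ (Metric.ball x r) < ∞ := by
  obtain ⟨K, hK, hxK⟩ := exists_compact_mem_nhds x
  obtain ⟨ε, hε, hεK⟩ := Metric.mem_nhds_iff.1 hxK
  obtain ⟨k, hk⟩ := exists_le_two_pow_mul hε r
  obtain ⟨A, hA⟩ := h.pow_two_mul k
  calc μ (Metric.ball x r) ≤ μ (Metric.ball x (2 ^ k * ε)) := by gcongr
    _ ≤ A * μ (Metric.ball x ε) := hA _ _ hε
    _ < ∞ := ENNReal.mul_lt_top ENNReal.coe_lt_top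
      ((measure_mono hεK).trans_lt hK.measure_lt_top)

/-- By doubling, all dilates of a null ball are null, and they exhaust the space. -/
theorem IsDoubling.ball_pos (h : IsDoubling μ) (h0 : μ ≠ 0) (x : X) {r : ℝ} (hr : 0 < r) :
    0 < μ (Metric.ball x r) := by
  rw [pos_iff_ne_zero]
  intro hx
  apply h0
  rw [← Measure.measure_univ_eq_zero, ← nonpos_iff_eq_zero]
  calc μ univ ≤ μ (⋃ k : ℕ, Metric.ball x (2 ^ k * r)) := by
        refine measure_mono fun y _ => ?_
        obtain ⟨k, hk⟩ := exists_le_two_pow_mul hr (dist y x + 1)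
        exact mem_iUnion.2 ⟨k, by rw [Metric.mem_ball]; linarith⟩
    _ ≤ ∑' k : ℕ, μ (Metric.ball x (2 ^ k * r)) := measure_iUnion_le _
    _ = 0 := by
        refine ENNReal.tsum_eq_zero.2 fun k => ?_
        obtain ⟨A, hA⟩ := h.pow_two_mul k
        have := hA x r hr
        rw [hx, mul_zero] at this
        exact nonpos_iff_eq_zero.1 this

/-- Balls in a doubling space are covered by finitely many balls of any given radius. -/
theorem IsDoubling.exists_finite_cover [BorelSpace X] [LocallyCompactSpace X]
    [IsFiniteMeasureOnCompacts μ]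
    (h : IsDoubling μ) (h0 : μ ≠ 0) (x : X) (r : ℝ) {ρ : ℝ} (hρ : 0 < ρ) :
    ∃ F : Set X, F.Finite ∧ Metric.ball x r ⊆ ⋃ y ∈ F, Metric.ball y ρ := by
  rcases le_or_gt r 0 with hr | hr
  · exact ⟨∅, finite_empty, by simp [Metric.ball_eq_empty.2 hr]⟩
  obtain ⟨u, hut, hdisj, hu⟩ := Vitali.exists_disjoint_subfamily_covering_enlargement
    (fun y : X => Metric.ball y (ρ / 2)) (Metric.ball x r) (fun _ => ρ / 2) 2 one_lt_two
    (fun _ _ => by positivity) (ρ / 2) (fun _ _ => le_rfl)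
    (fun y _ => Metric.nonempty_ball.2 (by positivity))
  refine ⟨u, ?_, fun y hy => ?_⟩
  -- For `y ∈ B(x, r)`, `B(x, r) ⊆ B(y, 2r)`, so doubling bounds the mass of every chosen `B(y,
  -- ρ/2)` below by one constant. These balls are disjoint inside `B(x, r + ρ)`, so there are
  -- finitely many.
  · obtain ⟨k, hk⟩ := exists_le_two_pow_mul (half_pos hρ) (2 * r)
    obtain ⟨A, hA⟩ := h.pow_two_mul k
    have hpos : 0 < μ (Metric.ball x r) / A :=
      ENNReal.div_pos (h.ball_pos h0 x hr).ne' ENNReal.coe_ne_top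
    have hfin := Measure.finite_const_le_meas_of_disjoint_iUnion μ hpos
      (As := fun y : u => Metric.ball (y : X) (ρ / 2)) (fun _ => measurableSet_ball)
      (fun a b hab => hdisj a.2 b.2 (Subtype.coe_injective.ne hab))
      ((measure_mono (t := Metric.ball x (r + ρ)) (iUnion_subset fun y z hz => by
          have := hut y.2
          rw [Metric.mem_ball] at *
          linarith [dist_triangle z y x])).trans_lt (h.ball_lt_top _ _)).ne
    have : {i : u | μ (Metric.ball x r) / A ≤ μ (Metric.ball (i : X) (ρ / 2))} = univ := by
      refine eq_univ_of_forall fun y => ?_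
      refine ENNReal.div_le_of_le_mul' ((measure_mono fun z hz => ?_).trans (hA y _ (half_pos hρ)))
      have := hut y.2
      rw [Metric.mem_ball] at *
      linarith [dist_triangle_right z y x]
    rw [this] at hfin
    exact @Set.toFinite _ u (finite_univ_iff.1 hfin)
  · obtain ⟨b, hb, ⟨z, hz, hz'⟩, -⟩ := hu y hy
    refine mem_biUnion hb ?_
    rw [Metric.mem_ball] at *
    linarith [dist_triangle_left y b z]

end Geometry

/-! ### The uncentred maximal function and its weak type bound -/

section MaximalFunction

variable {X : Type*} [MetricSpace X] [MeasurableSpace X]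

/-- The uncentred maximal function over balls of radius less than `R`. -/
def ballMax (μ : Measure X) (R : ℝ) (f : X → ℝ≥0∞) (x : X) : ℝ≥0∞ :=
  ⨆ (z : X) (r ∈ Ioo (0 : ℝ) R) (_ : x ∈ Metric.ball z r),
    (∫⁻ y in Metric.ball z r, f y ∂μ) / μ (Metric.ball z r)

variable {μ : Measure X} {R : ℝ} {f g : X → ℝ≥0∞}

theorem lt_ballMax_iff {l : ℝ≥0∞} {x : X} : l < ballMax μ R f x ↔
    ∃ z, ∃ r ∈ Ioo (0 : ℝ) R, x ∈ Metric.ball z r ∧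
      l < (∫⁻ y in Metric.ball z r, f y ∂μ) / μ (Metric.ball z r) := by
  simp only [ballMax, lt_iSup_iff, exists_prop]

/-- Superlevel sets of the uncentred maximal function are unions of open balls. This is why it
replaces the centred one, and no measurability of `f` is needed. -/
theorem measurable_ballMax [BorelSpace X] : Measurable (ballMax μ R f) := by
  refine LowerSemicontinuous.measurable (lowerSemicontinuous_iff_isOpen_preimage.2 fun l => ?_)
  have : ballMax μ R f ⁻¹' Ioi l = ⋃ (z : X) (r ∈ Ioo (0 : ℝ) R)
      (_ : l < (∫⁻ y in Metric.ball z r, f y ∂μ) / μ (Metric.ball z r)), Metric.ball z r := by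
    ext x
    simp only [mem_preimage, mem_Ioi, lt_ballMax_iff, mem_iUnion, exists_prop]
    tauto
  rw [this]
  exact isOpen_iUnion fun z => isOpen_biUnion fun r _ => isOpen_iUnion fun _ => Metric.isOpen_ball

theorem average_le_ballMax {x z : X} {r : ℝ} (hr : r ∈ Ioo (0 : ℝ) R) (hx : x ∈ Metric.ball z r) :
    (∫⁻ y in Metric.ball z r, f y ∂μ) / μ (Metric.ball z r) ≤ ballMax μ R f x :=
  le_iSup_of_le z (le_iSup₂_of_le r hr (le_iSup_of_le hx le_rfl))

theorem ballMax_le_of_forall {x : X} {a : ℝ≥0∞} (h : ∀ z, ∀ r ∈ Ioo (0 : ℝ) R,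
    x ∈ Metric.ball z r → (∫⁻ y in Metric.ball z r, f y ∂μ) / μ (Metric.ball z r) ≤ a) :
    ballMax μ R f x ≤ a :=
  iSup_le fun z => iSup₂_le fun r hr => iSup_le fun hx => h z r hr hx

theorem localMax_le_ballMax (f : X → ℝ) (x : X) :
    localMax μ R f x ≤ ballMax μ R (fun y => ‖f y‖ₑ) x :=
  iSup₂_le fun _ hr => average_le_ballMax hr (Metric.mem_ball_self hr.1)

theorem ballMax_add_le (hf : AEMeasurable f μ) (x : X) :
    ballMax μ R (fun y => f y + g y) x ≤ ballMax μ R f x + ballMax μ R g x := by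
  refine ballMax_le_of_forall fun z r hr hx => ?_
  rw [lintegral_add_left' hf.restrict, ENNReal.add_div]
  exact add_le_add (average_le_ballMax hr hx) (average_le_ballMax hr hx)

theorem ballMax_mono_ae (h : f ≤ᵐ[μ] g) (x : X) : ballMax μ R f x ≤ ballMax μ R g x := by
  refine ballMax_le_of_forall fun z r hr hx => le_trans ?_ (average_le_ballMax hr hx)
  exact ENNReal.div_le_div_right (lintegral_mono_ae (ae_restrict_of_ae h)) _

theorem ballMax_const_mul_le {c : ℝ≥0∞} (hc : c ≠ ∞) (x : X) :
    ballMax μ R (fun y => c * f y) x ≤ c * ballMax μ R f x := by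
  refine ballMax_le_of_forall fun z r hr hx => ?_
  rw [lintegral_const_mul' _ _ hc, mul_div_assoc]
  gcongr
  exact average_le_ballMax hr hx

theorem ballMax_le_indicator [BorelSpace X] (x₀ : X) {x : X} {n : ℝ}
    (hx : x ∈ Metric.ball x₀ n) :
    ballMax μ R f x ≤ ballMax μ R ((Metric.ball x₀ (n + 2 * R)).indicator f) x := by
  refine ballMax_le_of_forall fun z r hr hxz => le_trans ?_ (average_le_ballMax hr hxz)
  refine ENNReal.div_le_div_right (le_of_eq ?_) _
  refine setLIntegral_congr_fun measurableSet_ball fun y hy => ?_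
  rw [indicator_of_mem]
  have := hr.2
  rw [Metric.mem_ball] at *
  linarith [dist_triangle y z x₀, dist_triangle_left z x₀ x]

/-- The weak type `(1, 1)` inequality for the maximal function in a doubling space. -/
theorem IsDoubling.exists_weak_type [BorelSpace X] [TopologicalSpace.SeparableSpace X]
    (h : IsDoubling μ) : ∃ A : ℝ≥0, ∀ (R : ℝ) (f : X → ℝ≥0∞) (l : ℝ≥0∞),
      l * μ {x | l < ballMax μ R f x} ≤ A * ∫⁻ y, f y ∂μ := by
  -- A ball of radius at most `2ρ` meeting a selected ball of radius `ρ` lies in its fivefold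
  -- dilate; `2 ^ 3` is the next power of two.
  obtain ⟨A, hA⟩ := h.pow_two_mul 3
  refine ⟨A, fun R f l => ?_⟩
  set t : Set (X × ℝ) := {a | a.2 ∈ Ioo (0 : ℝ) R ∧
    l < (∫⁻ y in Metric.ball a.1 a.2, f y ∂μ) / μ (Metric.ball a.1 a.2)} with ht
  obtain ⟨u, hut, hdisj, hu⟩ := Vitali.exists_disjoint_subfamily_covering_enlargement
    (fun a : X × ℝ => Metric.ball a.1 a.2) t (fun a => a.2) 2 one_lt_two
    (fun a ha => ha.1.1.le) R (fun a ha => ha.1.2.le)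
    (fun a ha => Metric.nonempty_ball.2 ha.1.1)
  have hcount : u.Countable := hdisj.countable_of_isOpen (fun _ _ => Metric.isOpen_ball)
    fun a ha => Metric.nonempty_ball.2 (hut ha).1.1
  have hsub : {x | l < ballMax μ R f x} ⊆ ⋃ b ∈ u, Metric.ball b.1 (2 ^ 3 * b.2) := by
    intro x hx
    obtain ⟨z, r, hr, hxz, hl⟩ := lt_ballMax_iff.1 hx
    obtain ⟨b, hb, ⟨w, hw, hw'⟩, hle⟩ := hu (z, r) ⟨hr, hl⟩
    refine mem_biUnion hb ?_
    have := (hut hb).1.1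
    simp only [Metric.mem_ball] at *
    linarith [dist_triangle x z b.1, dist_triangle_left z b.1 w]
  calc l * μ {x | l < ballMax μ R f x}
      ≤ l * ∑' b : u, μ (Metric.ball b.1.1 (2 ^ 3 * b.1.2)) := by
        gcongr
        exact (measure_mono hsub).trans (measure_biUnion_le μ hcount _)
    _ = ∑' b : u, l * μ (Metric.ball b.1.1 (2 ^ 3 * b.1.2)) := ENNReal.tsum_mul_left.symm
    _ ≤ ∑' b : u, A * ∫⁻ y in Metric.ball b.1.1 b.1.2, f y ∂μ := by
        refine ENNReal.tsum_le_tsum fun b => ?_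
        obtain ⟨hb, hl⟩ := hut b.2
        calc l * μ (Metric.ball b.1.1 (2 ^ 3 * b.1.2))
            ≤ l * (A * μ (Metric.ball b.1.1 b.1.2)) := by gcongr; exact hA _ _ hb.1
          _ = A * (l * μ (Metric.ball b.1.1 b.1.2)) := by ring
          _ ≤ _ := by gcongr; exact ENNReal.mul_le_of_le_div hl.le
    _ = A * ∑' b : u, ∫⁻ y in Metric.ball b.1.1 b.1.2, f y ∂μ := ENNReal.tsum_mul_left
    _ = A * ∫⁻ y in ⋃ b ∈ u, Metric.ball b.1 b.2, f y ∂μ := by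
        rw [lintegral_biUnion hcount (fun _ _ => measurableSet_ball) hdisj]
    _ ≤ A * ∫⁻ y, f y ∂μ := by gcongr; exact Measure.restrict_le_self

end MaximalFunction

/-! ### Layer cake and Marcinkiewicz interpolation -/

section Interpolation

variable {α β : Type*} [MeasurableSpace α] [MeasurableSpace β]

/-- The real-valued layer cake formula is applied to `min F N`, and monotone convergence in `N`
admits the value `∞`. -/
theorem lintegral_rpow_le_lintegral_meas_lt_mul {ν : Measure α} {F : α → ℝ≥0∞} (hF : Measurable F)
    {p : ℝ} (hp : 0 < p) :
    ∫⁻ x, F x ^ p ∂ν ≤ ENNReal.ofReal p *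
      ∫⁻ t in Ioi (0 : ℝ), ν {x | ENNReal.ofReal t < F x} * ENNReal.ofReal (t ^ (p - 1)) := by
  have hsup : ∀ x, F x ^ p = ⨆ N : ℕ, (min (F x) N) ^ p := by
    intro x
    apply le_antisymm
    · rcases eq_or_ne (F x) ∞ with h | h
      · have : Tendsto (fun N : ℕ => (N : ℝ≥0∞) ^ p) atTop (𝓝 (∞ ^ p)) :=
          (ENNReal.continuous_rpow_const.tendsto _).comp ENNReal.tendsto_nat_nhds_top
        rw [h]
        refine le_of_tendsto this (Eventually.of_forall fun N => ?_)
        exact le_iSup_of_le N (by simp)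
      · obtain ⟨N, hN⟩ := ENNReal.exists_nat_gt h
        exact le_iSup_of_le N (by rw [min_eq_left hN.le])
    · exact iSup_le fun N => ENNReal.rpow_le_rpow (min_le_left _ _) hp.le
  simp_rw [hsup]
  rw [lintegral_iSup (fun N => (hF.min measurable_const).pow_const p)
    (fun N M hNM x => ENNReal.rpow_le_rpow (min_le_min_left _ (by exact_mod_cast hNM)) hp.le)]
  refine iSup_le fun N => ?_
  have hfin : ∀ x, min (F x) N ≠ ∞ := fun x =>
    ((min_le_right _ _).trans_lt (ENNReal.natCast_lt_top N)).ne
  have := lintegral_rpow_eq_lintegral_meas_lt_mul ν (f := fun x => (min (F x) N).toReal)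
    (Eventually.of_forall fun _ => ENNReal.toReal_nonneg)
    (hF.min measurable_const).ennreal_toReal.aemeasurable hp
  calc ∫⁻ x, min (F x) N ^ p ∂ν
      = ∫⁻ x, ENNReal.ofReal ((min (F x) N).toReal ^ p) ∂ν := by
        refine lintegral_congr fun x => ?_
        rw [← ENNReal.ofReal_rpow_of_nonneg ENNReal.toReal_nonneg hp.le,
          ENNReal.ofReal_toReal (hfin x)]
    _ ≤ _ := by
        rw [this]
        gcongr ENNReal.ofReal p * ?_
        refine setLIntegral_mono' measurableSet_Ioi fun t (ht : 0 < t) => ?_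
        gcongr with x
        exact fun hx => ((ENNReal.ofReal_lt_iff_lt_toReal ht.le (hfin x)).2 hx).trans_le
          (min_le_left _ _)

theorem lintegral_Ioi_indicator_rpow {p a : ℝ} (hp : 1 < p) (ha : 0 ≤ a) :
    ∫⁻ t in Ioi (0 : ℝ), (Iio a).indicator (fun t => ENNReal.ofReal (t ^ (p - 2))) t =
      ENNReal.ofReal (a ^ (p - 1) / (p - 1)) := by
  rw [lintegral_indicator measurableSet_Iio, Measure.restrict_restrict measurableSet_Iio,
    inter_comm, Ioi_inter_Iio, Measure.restrict_congr_set Ioo_ae_eq_Ioc,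
    ← ofReal_integral_eq_lintegral_ofReal, ← intervalIntegral.integral_of_le ha,
    integral_rpow (Or.inl (by linarith))]
  · rw [show p - 2 + 1 = p - 1 by ring, Real.zero_rpow (by linarith), sub_zero]
  · exact (intervalIntegral.intervalIntegrable_rpow' (by linarith)).1
  · filter_upwards [ae_restrict_mem measurableSet_Ioc] with t ht
    exact Real.rpow_nonneg ht.1.le _

/-- Marcinkiewicz interpolation between a weak type `(1, 1)` and an `L^∞` bound, starting from the
resulting inequality for truncations. -/
theorem lintegral_rpow_le_of_truncated_weak_type {ν : Measure α} {τ : Measure β} [SFinite τ]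
    {F : α → ℝ≥0∞} (hF : Measurable F) {G : β → ℝ≥0} (hG : Measurable G) {B D : ℝ≥0}
    {p : ℝ} (hp : 1 < p)
    (h : ∀ l : ℝ≥0, 0 < l → l * ν {x | l < F x} ≤ B * ∫⁻ y in {y | l < D * G y}, G y ∂τ) :
    ∫⁻ x, F x ^ p ∂ν ≤
      ENNReal.ofReal p * (B * ENNReal.ofReal (D ^ (p - 1) / (p - 1))) * ∫⁻ y, (G y : ℝ≥0∞) ^ p ∂τ := by
  refine (lintegral_rpow_le_lintegral_meas_lt_mul hF (by linarith)).trans ?_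
  rw [mul_assoc]
  gcongr
  calc ∫⁻ t in Ioi (0 : ℝ), ν {x | ENNReal.ofReal t < F x} * ENNReal.ofReal (t ^ (p - 1))
      ≤ ∫⁻ t in Ioi (0 : ℝ), B * ∫⁻ y, (G y : ℝ≥0∞) *
          (Iio (D * G y : ℝ)).indicator (fun t => ENNReal.ofReal (t ^ (p - 2))) t ∂τ := by
        refine setLIntegral_mono' measurableSet_Ioi fun t (ht : 0 < t) => ?_
        have hset : MeasurableSet {y | t.toNNReal < D * G y} :=
          measurableSet_lt measurable_const (hG.const_mul D)
        calc ν {x | ENNReal.ofReal t < F x} * ENNReal.ofReal (t ^ (p - 1))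
            -- One factor `t` is reserved for the weak type hypothesis; the remaining `t ^ (p - 2)`
            -- is integrable at `0` because `p > 1`.
            = (t.toNNReal * ν {x | t.toNNReal < F x}) * ENNReal.ofReal (t ^ (p - 2)) := by
              rw [show t ^ (p - 1) = t * t ^ (p - 2) by
                rw [← Real.rpow_one_add' ht.le (by linarith)]; ring_nf,
                ENNReal.ofReal_mul ht.le]
              simp only [ENNReal.ofReal]
              ring
          _ ≤ (B * ∫⁻ y in {y | t.toNNReal < D * G y}, G y ∂τ) * ENNReal.ofReal (t ^ (p - 2)) := by
              exact mul_le_mul' (h _ (Real.toNNReal_pos.2 ht)) le_rfl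
          _ = _ := by
              rw [mul_assoc, ← lintegral_indicator hset,
                ← lintegral_mul_const' _ _ ENNReal.ofReal_ne_top]
              congr 1
              refine lintegral_congr fun y => ?_
              have : t < D * G y ↔ t.toNNReal < D * G y := by
                rw [Real.toNNReal_lt_iff_lt_coe ht.le]; push_cast; rfl
              by_cases hy : t.toNNReal < D * G y
              · rw [indicator_of_mem (by exact hy), indicator_of_mem (by exact this.2 hy)]
              · rw [indicator_of_notMem (by exact hy),
                  indicator_of_notMem (by exact fun h' => hy (this.1 h'))]
                simp
    _ = B * ∫⁻ y, (∫⁻ t in Ioi (0 : ℝ), (G y : ℝ≥0∞) *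
          (Iio (D * G y : ℝ)).indicator (fun t => ENNReal.ofReal (t ^ (p - 2))) t) ∂τ := by
        rw [lintegral_const_mul' _ _ ENNReal.coe_ne_top, lintegral_lintegral_swap]
        refine Measurable.aemeasurable ?_
        refine (hG.coe_nnreal_ennreal.comp measurable_snd).mul ?_
        have hset : MeasurableSet {q : ℝ × β | q.1 < D * G q.2} :=
          measurableSet_lt measurable_fst
            ((hG.coe_nnreal_real.comp measurable_snd).const_mul (D : ℝ))
        exact ((measurable_fst.pow_const (p - 2)).ennreal_ofReal).indicator hset
    _ = B * ∫⁻ y, ENNReal.ofReal (D ^ (p - 1) / (p - 1)) * (G y : ℝ≥0∞) ^ p ∂τ := by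
        congr 1
        refine lintegral_congr fun y => ?_
        rw [lintegral_const_mul' _ _ ENNReal.coe_ne_top,
          lintegral_Ioi_indicator_rpow hp (by positivity), ← ENNReal.ofReal_coe_nnreal,
          ENNReal.ofReal_rpow_of_nonneg (by positivity) (by linarith),
          ← ENNReal.ofReal_mul (by positivity),
          ← ENNReal.ofReal_mul (div_nonneg (by positivity) (by linarith)),
          Real.mul_rpow (by positivity) (by positivity)]
        congr 1
        have : (G y : ℝ) ^ p = G y * (G y : ℝ) ^ (p - 1) := by
          rw [← Real.rpow_one_add' (by positivity) (by linarith)]; ring_nf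
        rw [this]; ring
    _ = B * ENNReal.ofReal (D ^ (p - 1) / (p - 1)) * ∫⁻ y, (G y : ℝ≥0∞) ^ p ∂τ := by
        rw [lintegral_const_mul' _ _ ENNReal.ofReal_ne_top, mul_assoc]

end Interpolation

/-! ### Duality between `L^p` and `L^{p'}` -/

section Duality

variable {α : Type*} [MeasurableSpace α] {μ : Measure α}

/-- If `F n` in the unit ball had pairing above `4 ^ n`, then `sup 2⁻ⁿ F n` would have infinite
pairing with `h`. Its `p`-th power is at most the sum of the `p`-th powers, so it lies in `L^p`
without appeal to Minkowski. -/
theorem exists_lintegral_mul_le_of_forall_lt_top {h : α → ℝ≥0∞} {p : ℝ} (hp : 1 ≤ p)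
    (H : ∀ F : α → ℝ≥0∞, Measurable F → ∫⁻ x, F x ^ p ∂μ < ∞ → ∫⁻ x, h x * F x ∂μ < ∞) :
    ∃ K : ℝ≥0, ∀ F : α → ℝ≥0∞, Measurable F → ∫⁻ x, F x ^ p ∂μ ≤ 1 → ∫⁻ x, h x * F x ∂μ ≤ K := by
  by_contra! hcon
  choose F hFm hF1 hFK using fun n : ℕ => hcon (4 ^ n)
  have hp0 : 0 < p := by linarith
  set c : ℕ → ℝ≥0∞ := fun n => (2⁻¹ : ℝ≥0∞) ^ n with hc
  have hc1 : ∀ n, c n ≤ 1 := fun n => pow_le_one₀ (by simp) (by simp)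
  have hlt := H (fun x => ⨆ n, c n * F n x) (Measurable.iSup fun n => (hFm n).const_mul _) (by
    calc ∫⁻ x, (⨆ n, c n * F n x) ^ p ∂μ ≤ ∫⁻ x, ∑' n, c n * F n x ^ p ∂μ := by
          refine lintegral_mono fun x => ?_
          rw [← ENNReal.le_rpow_inv_iff hp0]
          refine iSup_le fun n => ?_
          rw [ENNReal.le_rpow_inv_iff hp0, ENNReal.mul_rpow_of_nonneg _ _ hp0.le]
          refine le_trans ?_ (ENNReal.le_tsum n)
          gcongr
          exact (ENNReal.rpow_le_rpow_of_exponent_ge (hc1 n) hp).trans_eq (ENNReal.rpow_one _)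
      _ = ∑' n, c n * ∫⁻ x, F n x ^ p ∂μ := by
          rw [lintegral_tsum fun n => (((hFm n).pow_const p).const_mul _).aemeasurable]
          exact tsum_congr fun n => lintegral_const_mul _ ((hFm n).pow_const p)
      _ ≤ ∑' n, c n := ENNReal.tsum_le_tsum fun n => mul_le_of_le_one_right' (hF1 n)
      _ < ∞ := by
          rw [ENNReal.tsum_geometric, ENNReal.one_sub_inv_two, inv_inv]
          exact ENNReal.ofNat_lt_top)
  have hge : ∀ n : ℕ, (2 : ℝ≥0∞) ^ n ≤ ∫⁻ x, h x * ⨆ n, c n * F n x ∂μ := fun n =>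
    calc (2 : ℝ≥0∞) ^ n = c n * ((4 ^ n : ℝ≥0) : ℝ≥0∞) := by
          rw [hc]
          push_cast
          rw [← mul_pow, show (4 : ℝ≥0∞) = 2 * 2 by norm_num, ← mul_assoc,
            ENNReal.inv_mul_cancel (by simp) (by simp), one_mul]
      _ ≤ c n * ∫⁻ x, h x * F n x ∂μ := by gcongr; exact (hFK n).le
      _ = ∫⁻ x, h x * (c n * F n x) ∂μ := by
          rw [← lintegral_const_mul' _ _ ((hc1 n).trans_lt ENNReal.one_lt_top).ne]
          exact lintegral_congr fun x => by ring
      _ ≤ _ := by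
          gcongr with x
          exact le_iSup (fun n => c n * F n x) n
  obtain ⟨N, hN⟩ := ENNReal.exists_nat_gt hlt.ne
  exact (((hge N).trans_lt hN).trans (by exact_mod_cast N.lt_two_pow_self)).false

theorem conjExponent_ofReal {p : ℝ} (hp : 1 < p) :
    ENNReal.conjExponent (ENNReal.ofReal p) = ENNReal.ofReal p.conjExponent := by
  have h1 : 0 < p - 1 := by linarith
  rw [ENNReal.conjExponent, Real.conjExponent, ← ENNReal.ofReal_one, ← ENNReal.ofReal_sub _ zero_le_one,
    ← ENNReal.ofReal_inv_of_pos h1, ← ENNReal.ofReal_add zero_le_one (by positivity)]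
  congr 1
  field_simp
  ring

theorem eLpNorm_conjExponent_eq {p : ℝ} (hp : 1 < p) (h : α → ℝ≥0∞) :
    eLpNorm h (ENNReal.conjExponent (ENNReal.ofReal p)) μ =
      (∫⁻ x, h x ^ p.conjExponent ∂μ) ^ (1 / p.conjExponent) := by
  have hq := (Real.HolderConjugate.conjExponent hp).symm.pos
  rw [conjExponent_ofReal hp, eLpNorm_eq_lintegral_rpow_enorm_toReal
    (ENNReal.ofReal_pos.2 hq).ne' ENNReal.ofReal_ne_top, ENNReal.toReal_ofReal hq.le]
  simp

/-- A measurable function which is integrable against every function in `L^p` lies in `L^{p'}`. -/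
theorem eLpNorm_conjExponent_lt_top_of_forall_lintegral_mul_lt_top [SigmaFinite μ]
    {h : α → ℝ≥0∞} (hh : Measurable h) {p : ℝ} (hp : 1 ≤ p)
    (H : ∀ F : α → ℝ≥0∞, Measurable F → ∫⁻ x, F x ^ p ∂μ < ∞ → ∫⁻ x, h x * F x ∂μ < ∞) :
    eLpNorm h (ENNReal.conjExponent (ENNReal.ofReal p)) μ < ∞ := by
  obtain ⟨K, hK⟩ := exists_lintegral_mul_le_of_forall_lt_top hp H
  rcases hp.eq_or_lt with rfl | hp1
  · have : ENNReal.conjExponent (ENNReal.ofReal 1) = ∞ := by simp [ENNReal.conjExponent]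
    rw [this, eLpNorm_exponent_top]
    refine (essSup_le_of_ae_le ((K + 1 : ℝ≥0) : ℝ≥0∞) ?_).trans_lt ENNReal.coe_lt_top
    simp only [enorm_eq_self]
    by_contra hne
    have hS : MeasurableSet {x | ((K + 1 : ℝ≥0) : ℝ≥0∞) < h x} := measurableSet_lt measurable_const hh
    have hpos : 0 < μ {x | ((K + 1 : ℝ≥0) : ℝ≥0∞) < h x} := by
      rw [pos_iff_ne_zero]
      intro h0
      apply hne
      rw [EventuallyLE, ae_iff]
      simpa using h0
    -- For `p = 1`, testing against the normalised indicator of a piece of `{h > K + 1}` of positive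
    -- finite measure contradicts the bound `K`.
    obtain ⟨S, hSm, hSs, hS0, hSt⟩ := Measure.exists_subset_measure_lt_top hS hpos
    have h1 := hK (fun x => (μ S)⁻¹ * S.indicator 1 x)
      ((measurable_one.indicator hSm).const_mul _) (by
        simp only [ENNReal.rpow_one]
        rw [lintegral_const_mul _ (measurable_one.indicator hSm), lintegral_indicator_one hSm]
        exact ENNReal.inv_mul_le_one _)
    have h2 : ((K + 1 : ℝ≥0) : ℝ≥0∞) ≤ ∫⁻ x, h x * ((μ S)⁻¹ * S.indicator 1 x) ∂μ :=
      calc ((K + 1 : ℝ≥0) : ℝ≥0∞) = ∫⁻ x, (K + 1 : ℝ≥0) * ((μ S)⁻¹ * S.indicator 1 x) ∂μ := by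
            rw [lintegral_const_mul _ ((measurable_one.indicator hSm).const_mul _),
              lintegral_const_mul _ (measurable_one.indicator hSm), lintegral_indicator_one hSm,
              ENNReal.inv_mul_cancel hS0.ne' hSt.ne, mul_one]
        _ ≤ _ := by
            refine lintegral_mono fun x => ?_
            by_cases hx : x ∈ S
            · have : ((K + 1 : ℝ≥0) : ℝ≥0∞) < h x := hSs hx
              dsimp only
              gcongr
            · simp [hx]
    have := h2.trans h1
    rw [ENNReal.coe_le_coe] at this
    exact absurd this (by simp)
  have hpq := Real.HolderConjugate.conjExponent hp1
  set q := p.conjExponent with hq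
  rw [eLpNorm_conjExponent_eq hp1]
  refine ENNReal.rpow_lt_top_of_nonneg (by have := hpq.symm.pos; positivity) ?_
  -- Truncating in height and in space makes the `q`-th power integral `I` finite, so that dividing
  -- by a power of it is legitimate.
  set hN : ℕ → α → ℝ≥0∞ := fun N => (spanningSets μ N).indicator fun x => min (h x) N with hhN
  have hNm : ∀ N, Measurable (hN N) := fun N =>
    (hh.min measurable_const).indicator (measurableSet_spanningSets μ N)
  have hNh : ∀ N x, hN N x ≤ h x := fun N x =>
    (indicator_le_self' (fun _ _ => zero_le) x).trans (min_le_left _ _)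
  have hbound : ∀ N, ∫⁻ x, hN N x ^ q ∂μ ≤ (K : ℝ≥0∞) ^ q := by
    intro N
    set I := ∫⁻ x, hN N x ^ q ∂μ with hI
    rcases eq_or_ne I 0 with hI0 | hI0
    · rw [hI0]; exact zero_le
    have hIt : I ≠ ∞ := by
      refine ((lintegral_mono fun x => ?_ :
        I ≤ ∫⁻ x, (spanningSets μ N).indicator (fun _ => (N : ℝ≥0∞) ^ q) x ∂μ).trans_lt ?_).ne
      · by_cases hx : x ∈ spanningSets μ N
        · simp only [hhN, indicator_of_mem hx]
          exact ENNReal.rpow_le_rpow (min_le_right _ _) hpq.symm.nonneg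
        · simp [hhN, indicator_of_notMem hx, hpq.symm.pos]
      · rw [lintegral_indicator_const (measurableSet_spanningSets μ N)]
        exact ENNReal.mul_lt_top (ENNReal.rpow_lt_top_of_nonneg hpq.symm.nonneg
          (ENNReal.natCast_ne_top N)) (measure_spanningSets_lt_top μ N)
    -- The extremal function in Hölder's inequality, of norm one because `(q - 1) p = q`; it yields
    -- `I ^ (1 / q) ≤ K`.
    have h1 := hK (fun x => I ^ (-(1 / p)) * hN N x ^ (q - 1))
      (((hNm N).pow_const _).const_mul _) (by
        have : ∀ x, (I ^ (-(1 / p)) * hN N x ^ (q - 1)) ^ p = I⁻¹ * hN N x ^ q := fun x => by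
          rw [ENNReal.mul_rpow_of_nonneg _ _ hpq.nonneg, ← ENNReal.rpow_mul, ← ENNReal.rpow_mul]
          congr 1
          · rw [neg_mul, one_div, inv_mul_cancel₀ hpq.ne_zero, ENNReal.rpow_neg_one]
          · rw [hpq.symm.sub_one_mul_conj]
        simp_rw [this]
        rw [lintegral_const_mul _ ((hNm N).pow_const _)]
        exact ENNReal.inv_mul_le_one _)
    have h2 : I ^ (1 / q) ≤ ∫⁻ x, h x * (I ^ (-(1 / p)) * hN N x ^ (q - 1)) ∂μ :=
      calc I ^ (1 / q) = I ^ (-(1 / p)) * I := by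
            conv_rhs => rw [← ENNReal.rpow_one I, ← ENNReal.rpow_mul, ← ENNReal.rpow_add _ _ hI0 hIt]
            congr 1
            have := hpq.inv_add_inv_eq_one
            simp only [one_div]
            linarith
        _ = ∫⁻ x, I ^ (-(1 / p)) * hN N x ^ q ∂μ := by
            rw [lintegral_const_mul _ ((hNm N).pow_const _)]
        _ ≤ _ := by
            refine lintegral_mono fun x => ?_
            calc I ^ (-(1 / p)) * hN N x ^ q = I ^ (-(1 / p)) * (hN N x * hN N x ^ (q - 1)) := by
                  congr 1
                  conv_rhs => rw [← ENNReal.rpow_one (hN N x), ← ENNReal.rpow_mul, one_mul]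
                  rw [← ENNReal.rpow_add_of_nonneg _ _ zero_le_one (by linarith [hpq.symm.lt])]
                  ring_nf
              _ ≤ I ^ (-(1 / p)) * (h x * hN N x ^ (q - 1)) := by gcongr; exact hNh N x
              _ = _ := by ring
    have h3 := ENNReal.rpow_le_rpow (h2.trans h1) hpq.symm.nonneg
    rwa [← ENNReal.rpow_mul, one_div, inv_mul_cancel₀ hpq.symm.ne_zero, ENNReal.rpow_one] at h3
  have hlim : ∫⁻ x, h x ^ q ∂μ ≤ liminf (fun N => ∫⁻ x, hN N x ^ q ∂μ) atTop := by
    refine le_trans (lintegral_mono fun x => ?_) (lintegral_liminf_le fun N => (hNm N).pow_const q)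
    refine le_of_eq (Tendsto.liminf_eq ?_).symm
    refine (ENNReal.continuous_rpow_const.tendsto _).comp ?_
    have h1 : Tendsto (fun N : ℕ => min (h x) N) atTop (𝓝 (min (h x) ∞)) :=
      tendsto_const_nhds.min ENNReal.tendsto_nat_nhds_top
    rw [min_eq_left le_top] at h1
    refine h1.congr' ?_
    have hx : x ∈ ⋃ N, spanningSets μ N := by rw [iUnion_spanningSets]; trivial
    obtain ⟨M, hM⟩ := mem_iUnion.1 hx
    filter_upwards [eventually_ge_atTop M] with N hNM
    simp only [hhN, indicator_of_mem (monotone_spanningSets μ hNM hM)]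
  refine (hlim.trans ?_ |>.trans_lt (ENNReal.rpow_lt_top_of_nonneg hpq.symm.nonneg
    (ENNReal.coe_ne_top (r := K)))).ne
  exact liminf_le_of_le (by isBoundedDefault) fun b hb => by
    obtain ⟨N, hN'⟩ := hb.exists
    exact hN'.trans (hbound N)

end Duality

/-! ### Weighted norms and the construction of `u` -/

section Weights

variable {X : Type*} [MeasurableSpace X] {μ : Measure X} {v : X → ℝ}

theorem lintegral_weighted (hv : Measurable v) (g : X → ℝ≥0∞) :
    ∫⁻ x, g x ∂(weighted μ v) = ∫⁻ x, ENNReal.ofReal (v x) * g x ∂μ :=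
  lintegral_withDensity_eq_lintegral_mul_non_measurable μ hv.ennreal_ofReal
    (Eventually.of_forall fun _ => ENNReal.ofReal_lt_top) g

theorem ae_weighted_iff (hv : Measurable v) (hpos : ∀ x, 0 < v x) {P : X → Prop} :
    (∀ᵐ x ∂(weighted μ v), P x) ↔ ∀ᵐ x ∂μ, P x := by
  rw [weighted, ae_withDensity_iff hv.ennreal_ofReal]
  simp [hpos]

theorem absolutelyContinuous_weighted (hv : Measurable v) (hpos : ∀ x, 0 < v x) :
    μ ≪ weighted μ v :=
  withDensity_absolutelyContinuous' hv.ennreal_ofReal.aemeasurable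
    (Eventually.of_forall fun x => by simpa using hpos x)

theorem IsWeight.aestronglyMeasurable [MetricSpace X] (hv : IsWeight μ v) {f : X → ℝ}
    (hf : AEStronglyMeasurable f (weighted μ v)) : AEStronglyMeasurable f μ :=
  hf.mono_ac (absolutelyContinuous_weighted hv.measurable hv.pos)

theorem eLpNorm_weighted_rpow (hv : Measurable v) {p : ℝ} (hp : 0 < p) (f : X → ℝ) :
    eLpNorm f (ENNReal.ofReal p) (weighted μ v) ^ p =
      ∫⁻ x, ENNReal.ofReal (v x) * ‖f x‖ₑ ^ p ∂μ := by
  rw [eLpNorm_eq_lintegral_rpow_enorm_toReal (ENNReal.ofReal_pos.2 hp).ne' ENNReal.ofReal_ne_top,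
    ENNReal.toReal_ofReal hp.le, ← ENNReal.rpow_mul, one_div, inv_mul_cancel₀ hp.ne',
    ENNReal.rpow_one, lintegral_weighted hv]

theorem ofReal_mul_enorm_rpow {a : ℝ} (ha : 0 < a) {p : ℝ} (hp : 0 < p) (b : ℝ≥0∞) :
    ENNReal.ofReal a * b ^ p = (‖a ^ (1 / p)‖ₑ * b) ^ p := by
  rw [ENNReal.mul_rpow_of_nonneg _ _ hp.le, Real.enorm_of_nonneg (by positivity),
    ENNReal.ofReal_rpow_of_nonneg (by positivity) hp.le, ← Real.rpow_mul ha.le, one_div,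
    inv_mul_cancel₀ hp.ne', Real.rpow_one]

theorem enorm_rpow_neg_mul_self {a : ℝ} (ha : 0 < a) (s : ℝ) :
    ‖a ^ (-s)‖ₑ * ‖a ^ s‖ₑ = 1 := by
  rw [← enorm_mul, ← Real.rpow_add ha]
  simp

theorem eLpNorm_weighted_eq [MetricSpace X] (hv : IsWeight μ v) {p : ℝ} (hp : 0 < p) (f : X → ℝ) :
    eLpNorm f (ENNReal.ofReal p) (weighted μ v) =
      eLpNorm (fun x => v x ^ (1 / p) * f x) (ENNReal.ofReal p) μ := by
  simp only [eLpNorm_eq_lintegral_rpow_enorm_toReal (ENNReal.ofReal_pos.2 hp).ne'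
    ENNReal.ofReal_ne_top, ENNReal.toReal_ofReal hp.le, lintegral_weighted hv.measurable]
  congr 1
  refine lintegral_congr fun x => ?_
  rw [ofReal_mul_enorm_rpow (hv.pos x) hp, enorm_mul]

/-- Hölder's inequality between `L^p_v` and its dual with respect to `μ`. -/
theorem IsWeight.lintegral_mul_le [MetricSpace X] (hv : IsWeight μ v) {p : ℝ} (hp : 1 ≤ p) {κ : X → ℝ}
    (hκ : AEStronglyMeasurable κ μ) {f : X → ℝ} (hf : AEStronglyMeasurable f μ) :
    ∫⁻ x, ‖κ x‖ₑ * ‖f x‖ₑ ∂μ ≤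
      eLpNorm (fun x => v x ^ (-(1 / p)) * κ x) (ENNReal.conjExponent (ENNReal.ofReal p)) μ *
        eLpNorm f (ENNReal.ofReal p) (weighted μ v) := by
  have hp0 : 0 < p := by linarith
  rw [eLpNorm_weighted_eq hv hp0]
  have := ENNReal.HolderConjugate.conjExponent (p := ENNReal.ofReal p)
    (by simpa using ENNReal.ofReal_le_ofReal hp)
  have := this.symm
  refine le_trans (le_of_eq ?_) (eLpNorm_smul_le_mul_eLpNorm
    (((hv.measurable.pow_const _).aestronglyMeasurable).mul hf)
    (((hv.measurable.pow_const _).aestronglyMeasurable).mul hκ) (r := 1))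
  rw [eLpNorm_one_eq_lintegral_enorm]
  refine lintegral_congr fun x => ?_
  simp only [Pi.smul_apply', smul_eq_mul, enorm_mul, Pi.mul_apply]
  rw [show ∀ a b c d : ℝ≥0∞, a * b * (c * d) = a * c * (b * d) by intros; ring,
    enorm_rpow_neg_mul_self (hv.pos x), one_mul]

/-- Needed to build measurable levels from the dual norm of the kernel. For `p = 1` the essential
supremum exceeds `a` exactly where a section of a product set has positive measure, which depends
measurably on `x`. -/
theorem measurable_eLpNorm_conjExponent [SFinite μ] {p : ℝ} (hp : 1 ≤ p) {k : X → X → ℝ}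
    (hk : Measurable (Function.uncurry k)) :
    Measurable fun x => eLpNorm (k x) (ENNReal.conjExponent (ENNReal.ofReal p)) μ := by
  rcases hp.eq_or_lt with rfl | hp1
  · have : ENNReal.conjExponent (ENNReal.ofReal 1) = ∞ := by simp [ENNReal.conjExponent]
    simp only [this, eLpNorm_exponent_top, eLpNormEssSup]
    refine measurable_of_Ioi fun a => ?_
    have hset : (fun x => essSup (fun y => ‖k x y‖ₑ) μ) ⁻¹' Ioi a =
        {x | 0 < μ (Prod.mk x ⁻¹' {q : X × X | a < ‖Function.uncurry k q‖ₑ})} := by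
      ext x
      simp only [mem_preimage, mem_Ioi, mem_ofPred_eq]
      rw [← not_iff_not, not_lt, not_lt, nonpos_iff_eq_zero]
      constructor
      · intro h
        have := (ae_le_essSup (f := fun y => ‖k x y‖ₑ) (μ := μ)).mono fun y hy => hy.trans h
        rw [ae_iff] at this
        simpa using this
      · intro h
        refine essSup_le_of_ae_le a ?_
        rw [EventuallyLE, ae_iff]
        simpa using h
    rw [hset]
    exact measurableSet_lt measurable_const
      (measurable_measure_prodMk_left (measurableSet_lt measurable_const hk.enorm))
  · have hq := (Real.HolderConjugate.conjExponent hp1).symm.pos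
    simp only [conjExponent_ofReal hp1, eLpNorm_eq_lintegral_rpow_enorm_toReal
      (ENNReal.ofReal_pos.2 hq).ne' ENNReal.ofReal_ne_top]
    exact (Measurable.lintegral_prod_right' (f := fun q : X × X => ‖Function.uncurry k q‖ₑ ^
      (ENNReal.ofReal p.conjExponent).toReal) (hk.enorm.pow_const _)).pow_const _

theorem isWeight_of_le_one [MetricSpace X] [LocallyCompactSpace X] [TopologicalSpace.SeparableSpace X]
    [BorelSpace X] [IsFiniteMeasureOnCompacts μ] {u : X → ℝ} (hpos : ∀ x, 0 < u x)
    (hm : Measurable u) (h1 : ∀ x, u x ≤ 1) : IsWeight μ u := by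
  refine ⟨hpos, hm, ?_⟩
  have : SecondCountableTopology X := UniformSpace.secondCountable_of_separable X
  have hle : weighted μ u ≤ μ := by
    calc weighted μ u ≤ μ.withDensity 1 :=
          withDensity_mono (Eventually.of_forall fun x => by simpa using h1 x)
      _ = μ := withDensity_one
  have : IsFiniteMeasureOnCompacts (weighted μ u) :=
    ⟨fun K hK => (hle K).trans_lt hK.measure_lt_top⟩
  infer_instance

/-- A weight, constant on the level sets of `N : X → ℕ`, that compensates constants which depend
on the level. -/
def levelWeight (N : X → ℕ) (K : ℕ → ℝ≥0) (x : X) : ℝ :=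
  ((2⁻¹ ^ (N x + 1) / (1 + K (N x)) : ℝ≥0) : ℝ)

theorem isWeight_levelWeight [MetricSpace X] [LocallyCompactSpace X] [TopologicalSpace.SeparableSpace X]
    [BorelSpace X] [IsFiniteMeasureOnCompacts μ] {N : X → ℕ} (hN : Measurable N) (K : ℕ → ℝ≥0) :
    IsWeight μ (levelWeight N K) := by
  refine isWeight_of_le_one (fun x => ?_) ?_ fun x => ?_
  · rw [levelWeight]; positivity
  · exact (measurable_from_nat (f := fun n => ((2⁻¹ ^ (n + 1) / (1 + K n) : ℝ≥0) : ℝ))).comp hN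
  · rw [levelWeight]
    norm_cast
    refine div_le_one_of_le₀ ?_ (by positivity)
    calc (2⁻¹ : ℝ≥0) ^ (N x + 1) ≤ 1 := pow_le_one₀ (by positivity) (by
          rw [← NNReal.coe_le_coe]; norm_num)
      _ ≤ 1 + K (N x) := by simp

/-- Level `n` contributes at most `2^{-(n+1)} a`, since `K n / (1 + K n) ≤ 1`, and these
contributions sum to `a`. -/
theorem lintegral_levelWeight_le {N : X → ℕ} (hN : Measurable N) {K : ℕ → ℝ≥0}
    {F : X → ℝ≥0∞} {a : ℝ≥0∞} (h : ∀ n, ∫⁻ x in N ⁻¹' {n}, F x ∂μ ≤ K n * a) :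
    ∫⁻ x, F x ∂(weighted μ (levelWeight N K)) ≤ a := by
  have hm : Measurable (levelWeight N K) :=
    (measurable_from_nat (f := fun n => ((2⁻¹ ^ (n + 1) / (1 + K n) : ℝ≥0) : ℝ))).comp hN
  have hun : ⋃ n, N ⁻¹' {n} = univ := by ext; simp
  rw [lintegral_weighted hm, ← setLIntegral_univ, ← hun,
    lintegral_iUnion (fun n => hN (measurableSet_singleton n))
      (fun i j hij => Disjoint.preimage _ (by simpa using hij))]
  calc ∑' n, ∫⁻ x in N ⁻¹' {n}, ENNReal.ofReal (levelWeight N K x) * F x ∂μ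
      = ∑' n, ((2⁻¹ ^ (n + 1) / (1 + K n) : ℝ≥0) : ℝ≥0∞) * ∫⁻ x in N ⁻¹' {n}, F x ∂μ := by
        refine tsum_congr fun n => ?_
        rw [← lintegral_const_mul' _ _ ENNReal.coe_ne_top]
        refine setLIntegral_congr_fun (hN (measurableSet_singleton n)) fun x hx => ?_
        have hx : N x = n := hx
        rw [levelWeight, hx, ENNReal.ofReal_coe_nnreal]
    _ ≤ ∑' n : ℕ, ((2⁻¹ : ℝ≥0∞) ^ (n + 1)) * a := by
        refine ENNReal.tsum_le_tsum fun n => ?_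
        calc ((2⁻¹ ^ (n + 1) / (1 + K n) : ℝ≥0) : ℝ≥0∞) * ∫⁻ x in N ⁻¹' {n}, F x ∂μ
            ≤ ((2⁻¹ ^ (n + 1) / (1 + K n) : ℝ≥0) : ℝ≥0∞) * (K n * a) := by gcongr; exact h n
          _ = ((2⁻¹ ^ (n + 1) / (1 + K n) * K n : ℝ≥0) : ℝ≥0∞) * a := by push_cast; ring
          _ ≤ ((2⁻¹ ^ (n + 1) : ℝ≥0) : ℝ≥0∞) * a := by
              gcongr
              rw [div_mul_eq_mul_div]
              refine div_le_of_le_mul₀ (by positivity) (by positivity) ?_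
              gcongr
              simp
          _ = _ := by
              rw [ENNReal.coe_pow, ENNReal.coe_inv (by norm_num)]
              rfl
    _ = a := by
        rw [ENNReal.tsum_mul_right]
        simp_rw [pow_succ]
        rw [ENNReal.tsum_mul_right, ENNReal.tsum_geometric, ENNReal.one_sub_inv_two, inv_inv,
          ENNReal.mul_inv_cancel (by simp) (by simp), one_mul]

end Weights

/-! ### Admissible times -/

section Time

variable {T : ℝ≥0∞} {s t : ℝ}

theorem IsTime.mono (ht : IsTime T t) (hs : 0 < s) (hst : s ≤ t) : IsTime T s :=
  ⟨hs, (ENNReal.ofReal_le_ofReal hst).trans_lt ht.2⟩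

theorem exists_isTime (hT : 0 < T) : ∃ t, IsTime T t := by
  obtain ⟨r, h0, hr⟩ := ENNReal.lt_iff_exists_nnreal_btwn.1 hT
  exact ⟨r, by exact_mod_cast h0, by simpa using hr⟩

end Time

/-! ### Kernel integrals and the necessity of `D_p` -/

section Kernel

variable {X : Type*} [MeasurableSpace X] {μ : Measure X} {T : ℝ≥0∞}
  {φ : ℝ → X → X → ℝ≥0} {t R : ℝ} {f g : X → ℝ} {x : X}

theorem IsHeatKernel.measurable_right (hφ : IsHeatKernel μ T φ) (ht : IsTime T t) (x : X) :
    Measurable (φ t x) :=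
  (hφ.measurable t ht).of_uncurry_left

theorem IsHeatKernel.measure_ne_zero [Nonempty X] (hφ : IsHeatKernel μ T φ) (hT : 0 < T) :
    μ ≠ 0 := by
  rintro rfl
  obtain ⟨t, ht⟩ := exists_isTime hT
  obtain ⟨x⟩ := ‹Nonempty X›
  simpa using hφ.conservative t ht x

theorem IsHeatKernel.converges_iff (hφ : IsHeatKernel μ T φ) (ht : IsTime T t)
    (hf : AEStronglyMeasurable f μ) :
    Converges μ φ t f x ↔ ∫⁻ y, (φ t x y : ℝ≥0∞) * ‖f y‖ₑ ∂μ < ∞ := by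
  have hm : AEStronglyMeasurable (fun y => (φ t x y : ℝ) * f y) μ :=
    (hφ.measurable_right ht x).coe_nnreal_real.aestronglyMeasurable.mul hf
  rw [Converges, Integrable, and_iff_right hm, HasFiniteIntegral]
  simp [enorm_mul]

theorem enorm_S_le : ‖S μ φ t f x‖ₑ ≤ ∫⁻ y, (φ t x y : ℝ≥0∞) * ‖f y‖ₑ ∂μ := by
  refine (enorm_integral_le_lintegral_enorm _).trans_eq ?_
  simp [enorm_mul]

/-- Since `|S_t f| ≤ S_t |f|` and both integrals converge absolutely together, the operator may be
tested on a measurable, everywhere non-negative representative of `|f|`, as the maximal inequality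
requires. -/
theorem IsHeatKernel.timeMax_le (hφ : IsHeatKernel μ T φ) (hR : IsTime T R)
    (hf : AEStronglyMeasurable f μ) {g : X → ℝ} (hg : Measurable g) (hg0 : ∀ y, 0 ≤ g y)
    (hfg : ∀ᵐ y ∂μ, |f y| = g y) (x : X) : timeMax μ φ R f x ≤ timeMax μ φ R g x := by
  refine iSup₂_mono fun t ht => ?_
  have htT : IsTime T t := hR.mono ht.1 ht.2.le
  have hint : ∫⁻ y, (φ t x y : ℝ≥0∞) * ‖f y‖ₑ ∂μ = ∫⁻ y, (φ t x y : ℝ≥0∞) * ‖g y‖ₑ ∂μ := by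
    refine lintegral_congr_ae (hfg.mono fun y hy => ?_)
    dsimp only
    rw [← hy, Real.enorm_abs]
  by_cases hc : Converges μ φ t g x
  · have hcf : Converges μ φ t f x := by
      rwa [hφ.converges_iff htT hf, hint,
        ← hφ.converges_iff htT hg.aestronglyMeasurable]
    rw [if_pos hc, if_pos hcf]
    refine enorm_S_le.trans_eq (hint.trans ?_)
    rw [S, Real.enorm_of_nonneg
      (integral_nonneg (f := fun y => (φ t x y : ℝ) * g y) fun y => mul_nonneg (φ t x y).coe_nonneg (hg0 y)),
      ofReal_integral_eq_lintegral_ofReal hc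
        (Eventually.of_forall fun y => mul_nonneg (φ t x y).coe_nonneg (hg0 y))]
    refine lintegral_congr fun y => ?_
    rw [ENNReal.ofReal_mul (φ t x y).coe_nonneg, Real.enorm_of_nonneg (hg0 y)]
    simp
  · rw [if_neg hc]
    exact le_top

/-- Passage from non-negative measurable functions to arbitrary ones in a bound for `timeMax`. -/
theorem IsHeatKernel.timeMax_le_of_forall [MetricSpace X] (hφ : IsHeatKernel μ T φ) {γ Γ a b : ℝ}
    (hR : IsTime T R)
    (h : ∀ f : X → ℝ, Measurable f → (∀ y, 0 ≤ f y) →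
      timeMax μ φ R f x ≤ ENNReal.ofReal a * localMax μ Γ f x +
        ENNReal.ofReal b * ∫⁻ y, (φ (γ * R) x y : ℝ≥0∞) * ENNReal.ofReal (f y) ∂μ)
    (hf : AEStronglyMeasurable f μ) :
    timeMax μ φ R f x ≤ ENNReal.ofReal a * ballMax μ Γ (fun y => ‖f y‖ₑ) x +
        ENNReal.ofReal b * ∫⁻ y, (φ (γ * R) x y : ℝ≥0∞) * ‖f y‖ₑ ∂μ := by
  set g : X → ℝ := fun y => |hf.mk f y| with hg
  have hgm : Measurable g := hf.stronglyMeasurable_mk.measurable.abs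
  have hg0 : ∀ y, 0 ≤ g y := fun y => abs_nonneg _
  have hfg : ∀ᵐ y ∂μ, |f y| = g y := hf.ae_eq_mk.mono fun y hy => by rw [hg, hy]
  have hfg' : ∀ᵐ y ∂μ, ‖g y‖ₑ = ‖f y‖ₑ := hfg.mono fun y hy => by rw [← hy, Real.enorm_abs]
  refine (hφ.timeMax_le hR hf hgm hg0 hfg x).trans ((h g hgm hg0).trans ?_)
  refine add_le_add (mul_le_mul_right ((localMax_le_ballMax g x).trans
    (ballMax_mono_ae (hfg'.mono fun _ h => h.le) x)) _) (le_of_eq ?_)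
  congr 1
  refine lintegral_congr_ae (hfg'.mono fun y hy => ?_)
  dsimp only
  rw [← hy, Real.enorm_of_nonneg (hg0 y)]

theorem IsHeatKernel.converges_of_harnack (hφ : IsHeatKernel μ T φ) {s : ℝ} {x₁ x₂ : X}
    (ht : IsTime T t) (hs : IsTime T s) (h : ∃ C : ℝ≥0, ∀ y, φ s x₁ y ≤ C * φ t x₂ y)
    (hf : AEStronglyMeasurable f μ) (hc : Converges μ φ t f x₂) : Converges μ φ s f x₁ := by
  obtain ⟨C, hC⟩ := h
  rw [hφ.converges_iff ht hf] at hc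
  rw [hφ.converges_iff hs hf]
  calc ∫⁻ y, (φ s x₁ y : ℝ≥0∞) * ‖f y‖ₑ ∂μ ≤ ∫⁻ y, C * ((φ t x₂ y : ℝ≥0∞) * ‖f y‖ₑ) ∂μ := by
        refine lintegral_mono fun y => ?_
        rw [← mul_assoc]
        gcongr
        rw [← ENNReal.coe_mul]
        exact ENNReal.coe_le_coe.2 (hC y)
    _ = C * ∫⁻ y, (φ t x₂ y : ℝ≥0∞) * ‖f y‖ₑ ∂μ := lintegral_const_mul' _ _ ENNReal.coe_ne_top
    _ < ∞ := ENNReal.mul_lt_top ENNReal.coe_lt_top hc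

/-- Convergence of the integrals of all functions in `L^p_v` forces the dual norm condition. -/
theorem inD_of_forall_exists_converges [MetricSpace X] [SigmaFinite μ] [Nonempty X] (hφ : IsHeatKernel μ T φ)
    (hA : KernelAssumption μ T φ) {p : ℝ} (hp : 1 ≤ p) {v : X → ℝ} (hv : IsWeight μ v)
    (hR : IsTime T R)
    (h : ∀ f : X → ℝ, MemLp f (ENNReal.ofReal p) (weighted μ v) → ∃ x, Converges μ φ R f x) :
    InD μ T φ p v := by
  have hp0 : 0 < p := by linarith
  obtain ⟨η, hη0, hη1, hη⟩ := hA.harnack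
  have hηR : IsTime T (η * R) :=
    hR.mono (mul_pos hη0 hR.1) (mul_le_of_le_one_left hR.1.le hη1)
  obtain ⟨x₀⟩ := ‹Nonempty X›
  refine ⟨η * R, hηR, x₀, ?_⟩
  have hκ := (hφ.measurable_right hηR x₀).coe_nnreal_real
  rw [← eLpNorm_enorm]
  refine eLpNorm_conjExponent_lt_top_of_forall_lintegral_mul_lt_top
    ((hv.measurable.pow_const _).mul hκ).enorm hp fun F hF hFp => ?_
  have hFtop : ∀ᵐ y ∂μ, F y < ∞ := by
    filter_upwards [ae_lt_top (hF.pow_const p) hFp.ne] with y hy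
    exact lt_of_not_ge fun h => by simp [top_le_iff.1 h, hp0] at hy
  -- Multiplication by `v^{-1/p}` carries `L^p(μ)` isometrically into `L^p_v`.
  set f : X → ℝ := fun y => v y ^ (-(1 / p)) * (F y).toReal with hf
  have hfm : Measurable f := (hv.measurable.pow_const _).mul hF.ennreal_toReal
  have hFe : ∀ᵐ y ∂μ, ‖f y‖ₑ = ‖v y ^ (-(1 / p))‖ₑ * F y := hFtop.mono fun y hy => by
    rw [hf, enorm_mul, Real.enorm_of_nonneg (r := (F y).toReal) ENNReal.toReal_nonneg,
      ENNReal.ofReal_toReal hy.ne]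
  have hfp : MemLp f (ENNReal.ofReal p) (weighted μ v) := by
    refine ⟨hfm.aestronglyMeasurable, ?_⟩
    rw [← ENNReal.rpow_lt_top_iff_of_pos hp0, eLpNorm_weighted_rpow hv.measurable hp0]
    refine lt_of_eq_of_lt (lintegral_congr_ae (hFe.mono fun y hy => ?_)) hFp
    dsimp only
    rw [ofReal_mul_enorm_rpow (hv.pos y) hp0, hy, ← mul_assoc, mul_comm ‖v y ^ (1 / p)‖ₑ,
      enorm_rpow_neg_mul_self (hv.pos y), one_mul]
  obtain ⟨x, hx⟩ := h f hfp
  -- The point `x` varies with `f`; Harnack moves it to the fixed `x₀` at the cost of passing to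
  -- time `η * R`.
  replace hx := hφ.converges_of_harnack hR hηR (hη R hR x₀ x) hfm.aestronglyMeasurable hx
  rw [hφ.converges_iff hηR hfm.aestronglyMeasurable] at hx
  calc ∫⁻ y, ‖v y ^ (-(1 / p)) * (φ (η * R) x₀ y : ℝ)‖ₑ * F y ∂μ
      = ∫⁻ y, (φ (η * R) x₀ y : ℝ≥0∞) * ‖f y‖ₑ ∂μ := by
        refine lintegral_congr_ae (hFe.mono fun y hy => ?_)
        dsimp only
        rw [hy, enorm_mul]
        simp only [NNReal.enorm_eq]
        ring
    _ < ∞ := hx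

end Kernel

/-! ### From maximal bounds to almost everywhere convergence -/

section AlmostEverywhere

variable {X : Type*} [MeasurableSpace X] {μ : Measure X} {T : ℝ≥0∞}
  {φ : ℝ → X → X → ℝ≥0} {t R : ℝ} {f g : X → ℝ} {x : X}

/-- Chebyshev for each measurable majorant, followed by the infimum over majorants. -/
theorem rpow_mul_measure_lt_le_upperLpNorm {ν : Measure X} {p : ℝ} (hp : 0 < p)
    (F : X → ℝ≥0∞) (l : ℝ≥0∞) :
    l ^ p * ν {x | l < F x} ≤ upperLpNorm F (ENNReal.ofReal p) ν ^ p := by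
  rw [← ENNReal.rpow_inv_le_iff hp]
  refine le_iInf fun g => le_iInf fun hg => le_iInf fun hFg => ?_
  rw [ENNReal.rpow_inv_le_iff hp]
  have := mul_meas_ge_le_pow_eLpNorm' ν (ENNReal.ofReal_pos.2 hp).ne' ENNReal.ofReal_ne_top
    hg.aestronglyMeasurable l
  rw [ENNReal.toReal_ofReal hp.le] at this
  refine le_trans ?_ this
  gcongr with x
  exact fun hx => hx.le.trans (hFg x)

theorem exists_weak_type_of_bounded {p : ℝ} (hp : 1 ≤ p) {v u : X → ℝ}
    (hs : 1 < p → StrongBounded μ φ p R v u) (hw : p = 1 → WeakBounded μ φ R v u) :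
    ∃ C : ℝ≥0, ∀ f : X → ℝ, MemLp f (ENNReal.ofReal p) (weighted μ v) → ∀ l : ℝ≥0, 0 < l →
      (l : ℝ≥0∞) ^ p * weighted μ u {x | l < timeMax μ φ R f x} ≤
        (C * eLpNorm f (ENNReal.ofReal p) (weighted μ v)) ^ p := by
  rcases hp.eq_or_lt with rfl | hp1
  · obtain ⟨C, hC⟩ := hw rfl
    refine ⟨C, fun f hf l hl => ?_⟩
    simpa using hC f (by simpa using hf) l hl
  · obtain ⟨C, hC⟩ := hs hp1
    refine ⟨C, fun f hf l _ => ?_⟩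
    exact (rpow_mul_measure_lt_le_upperLpNorm (by linarith) _ _).trans
      (ENNReal.rpow_le_rpow (hC f hf) (by linarith))

/-- If `l ^ p * ν (E n l) ≤ (C * ε n) ^ p` where `∑ ε n ^ p` converges, then almost every point
belongs to only finitely many of the sets `E n l`, for each `l = 1 / (m + 1)`. -/
theorem ae_eventually_notMem_of_weak_type {ν : Measure X} {E : ℕ → ℝ≥0 → Set X} {p : ℝ} (hp : 1 ≤ p)
    {C : ℝ≥0} (h : ∀ n, ∀ l : ℝ≥0, 0 < l →
      (l : ℝ≥0∞) ^ p * ν (E n l) ≤ (C * 2⁻¹ ^ n) ^ p) :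
    ∀ᵐ x ∂ν, ∀ m : ℕ, ∀ᶠ n in atTop, x ∉ E n (1 / (m + 1)) := by
  have hp0 : 0 < p := by linarith
  refine ae_all_iff.2 fun m => ?_
  refine ae_eventually_notMem ?_
  set l : ℝ≥0 := 1 / (m + 1) with hl
  have hl0 : 0 < l := by positivity
  have hlp : (l : ℝ≥0∞) ^ p ≠ 0 := by simp [hl0.ne', hp0]
  have hlt : (l : ℝ≥0∞) ^ p ≠ ∞ := (ENNReal.rpow_lt_top_of_nonneg hp0.le ENNReal.coe_ne_top).ne
  refine ((ENNReal.tsum_le_tsum fun n => ?_ : _ ≤ ∑' n : ℕ,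
    ((C : ℝ≥0∞) ^ p / (l : ℝ≥0∞) ^ p) * 2⁻¹ ^ n).trans_lt ?_).ne
  · rw [div_eq_mul_inv, mul_right_comm, ← div_eq_mul_inv, ENNReal.le_div_iff_mul_le (Or.inl hlp)
      (Or.inl hlt), mul_comm]
    refine (h n l hl0).trans ?_
    rw [ENNReal.mul_rpow_of_nonneg _ _ hp0.le]
    gcongr
    exact (ENNReal.rpow_le_rpow_of_exponent_ge (pow_le_one₀ (by simp) (by simp)) hp).trans_eq
      (ENNReal.rpow_one _)
  · rw [ENNReal.tsum_mul_left, ENNReal.tsum_geometric, ENNReal.one_sub_inv_two, inv_inv]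
    exact ENNReal.mul_lt_top (ENNReal.div_lt_top
      (ENNReal.rpow_lt_top_of_nonneg hp0.le ENNReal.coe_ne_top).ne hlp) ENNReal.ofNat_lt_top

theorem converges_of_timeMax_lt_top (h : timeMax μ φ R f x < ∞) (ht : t ∈ Ioo 0 R) :
    Converges μ φ t f x := by
  by_contra hc
  refine h.not_ge ?_
  refine le_iSup₂_of_le t ht ?_
  rw [if_neg hc]

theorem enorm_S_le_timeMax (h : timeMax μ φ R f x < ∞) (ht : t ∈ Ioo 0 R) :
    ‖S μ φ t f x‖ₑ ≤ timeMax μ φ R f x := by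
  refine le_iSup₂_of_le t ht ?_
  rw [if_pos (converges_of_timeMax_lt_top h ht)]

theorem IsHeatKernel.converges_of_continuous [MetricSpace X] [BorelSpace X]
    (hφ : IsHeatKernel μ T φ) (ht : IsTime T t)
    (hg : Continuous g) (hgc : HasCompactSupport g) (x : X) : Converges μ φ t g x := by
  have hgm : Measurable g := hg.measurable
  obtain ⟨C, hC⟩ := hgc.exists_bound_of_continuous hg
  rw [hφ.converges_iff ht hgm.aestronglyMeasurable]
  calc ∫⁻ y, (φ t x y : ℝ≥0∞) * ‖g y‖ₑ ∂μ ≤ ∫⁻ y, (φ t x y : ℝ≥0∞) * ENNReal.ofReal C ∂μ := by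
        gcongr with y
        rw [← ofReal_norm]
        exact ENNReal.ofReal_le_ofReal (hC y)
    _ = ENNReal.ofReal C := by
        rw [lintegral_mul_const' _ _ ENNReal.ofReal_ne_top, hφ.conservative t ht x, one_mul]
    _ < ∞ := ENNReal.ofReal_lt_top

/-- An `ε/3` argument: `S_t f - f = S_t(f - g n) + (S_t g n - g n) + (g n - f)`, with the first term
controlled uniformly in `t` by the maximal function. Finiteness of the latter also forces absolute
convergence, by the convention on the value `∞`. -/
theorem tendsto_S_of_approx (hR : 0 < R) (g : ℕ → X → ℝ)
    (hgc : ∀ n, ∀ t ∈ Ioo 0 R, Converges μ φ t (g n) x)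
    (hgt : ∀ n, Tendsto (fun t => S μ φ t (g n) x) (𝓝[>] 0) (𝓝 (g n x)))
    (h1 : ∀ m : ℕ, ∀ᶠ n in atTop, timeMax μ φ R (f - g n) x ≤ ((1 / (m + 1) : ℝ≥0) : ℝ≥0∞))
    (h2 : ∀ m : ℕ, ∀ᶠ n in atTop, ‖(f - g n) x‖ₑ ≤ ((1 / (m + 1) : ℝ≥0) : ℝ≥0∞)) :
    (∀ t ∈ Ioo 0 R, Converges μ φ t f x) ∧
      Tendsto (fun t => S μ φ t f x) (𝓝[>] 0) (𝓝 (f x)) := by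
  have hsplit : ∀ n, timeMax μ φ R (f - g n) x < ∞ → ∀ t ∈ Ioo 0 R,
      Converges μ φ t f x ∧ S μ φ t f x = S μ φ t (f - g n) x + S μ φ t (g n) x := by
    intro n hn t ht
    have hc := converges_of_timeMax_lt_top hn ht
    have heq : (fun y => (φ t x y : ℝ) * f y) =
        fun y => (φ t x y : ℝ) * (f - g n) y + (φ t x y : ℝ) * g n y := by
      ext y; simp only [Pi.sub_apply]; ring
    refine ⟨?_, ?_⟩
    · rw [Converges, heq]; exact Integrable.add hc (hgc n t ht)
    · rw [S, heq]; exact integral_add hc (hgc n t ht)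
  refine ⟨fun t ht => ?_, ?_⟩
  · obtain ⟨n, hn⟩ := (h1 0).exists
    exact (hsplit n (hn.trans_lt ENNReal.coe_lt_top) t ht).1
  · refine Metric.tendsto_nhds.2 fun ε hε => ?_
    obtain ⟨m, hm⟩ := exists_nat_one_div_lt (show 0 < ε / 3 by positivity)
    obtain ⟨n, hn1, hn2⟩ := ((h1 m).and (h2 m)).exists
    have hlt := hn1.trans_lt ENNReal.coe_lt_top
    have hnorm : ∀ a : ℝ, ‖a‖ₑ ≤ ((1 / (m + 1) : ℝ≥0) : ℝ≥0∞) → |a| < ε / 3 := by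
      intro a ha
      rw [enorm_eq_nnnorm, ENNReal.coe_le_coe, ← NNReal.coe_le_coe] at ha
      push_cast at ha
      exact ha.trans_lt hm
    filter_upwards [Ioo_mem_nhdsGT hR, Metric.tendsto_nhds.1 (hgt n) (ε / 3) (by positivity)]
      with t ht htn
    have e1 := hnorm _ ((enorm_S_le_timeMax hlt ht).trans hn1)
    have e2 := hnorm _ hn2
    rw [Real.dist_eq] at htn ⊢
    rw [(hsplit n hlt t ht).2]
    simp only [Pi.sub_apply] at e2
    rw [abs_lt] at *
    constructor <;> linarith [e1.1, e1.2, e2.1, e2.2, htn.1, htn.2]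

/-- A weak type bound for the maximal operator yields almost everywhere convergence. -/
theorem ae_tendsto_of_bounded [MetricSpace X] [BorelSpace X] [LocallyCompactSpace X]
    (hφ : IsHeatKernel μ T φ) (hA : KernelAssumption μ T φ) {p : ℝ} (hp : 1 ≤ p)
    {v u : X → ℝ} (hv : IsWeight μ v) (hu : IsWeight μ u) (hR : IsTime T R)
    (hs : 1 < p → StrongBounded μ φ p R v u) (hw : p = 1 → WeakBounded μ φ R v u)
    (hf : MemLp f (ENNReal.ofReal p) (weighted μ v)) :
    ∀ᵐ x ∂μ, (∀ t ∈ Ioo 0 R, Converges μ φ t f x) ∧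
      Tendsto (fun t => S μ φ t f x) (𝓝[>] 0) (𝓝 (f x)) := by
  have hp0 : 0 < p := by linarith
  have := hv.radon
  obtain ⟨C, hC⟩ := exists_weak_type_of_bounded hp hs hw
  -- Density of compactly supported continuous functions rests on the regularity of `v dμ`; the
  -- errors `2⁻ⁿ` are summable for Borel–Cantelli.
  choose g hgs hgf hgc hgp using fun n : ℕ => hf.exists_hasCompactSupport_eLpNorm_sub_le
    ENNReal.ofReal_ne_top (ε := 2⁻¹ ^ n) (by simp)
  have h1 : ∀ᵐ x ∂μ, ∀ m : ℕ, ∀ᶠ n in atTop,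
      timeMax μ φ R (f - g n) x ≤ ((1 / (m + 1) : ℝ≥0) : ℝ≥0∞) := by
    rw [← ae_weighted_iff hu.measurable hu.pos]
    have := ae_eventually_notMem_of_weak_type (ν := weighted μ u)
      (E := fun n l => {x | (l : ℝ≥0∞) < timeMax μ φ R (f - g n) x}) hp (C := C) (fun n l hl =>
        (hC _ (hf.sub (hgp n)) l hl).trans (by
          refine ENNReal.rpow_le_rpow ?_ hp0.le
          gcongr
          exact hgf n))
    simpa using this
  have h2 : ∀ᵐ x ∂μ, ∀ m : ℕ, ∀ᶠ n in atTop,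
      ‖(f - g n) x‖ₑ ≤ ((1 / (m + 1) : ℝ≥0) : ℝ≥0∞) := by
    rw [← ae_weighted_iff hv.measurable hv.pos]
    have := ae_eventually_notMem_of_weak_type (ν := weighted μ v)
      (E := fun n l => {x | (l : ℝ≥0∞) < ‖(f - g n) x‖ₑ}) hp (C := 1) (fun n l hl => by
        have := mul_meas_ge_le_pow_eLpNorm' (weighted μ v) (ENNReal.ofReal_pos.2 hp0).ne'
          ENNReal.ofReal_ne_top (hf.sub (hgp n)).1 l
        rw [ENNReal.toReal_ofReal hp0.le] at this
        refine le_trans ?_ (this.trans (ENNReal.rpow_le_rpow ?_ hp0.le))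
        · gcongr with x
          exact fun hx => hx.le
        · simpa using hgf n)
    simpa using this
  filter_upwards [h1, h2] with x hx1 hx2
  exact tendsto_S_of_approx hR.1 g
    (fun n t ht => hφ.converges_of_continuous (hR.mono ht.1 ht.2.le) (hgc n) (hgs n) x)
    (fun n => hA.vague _ (hgc n) (hgs n) x) hx1 hx2

end AlmostEverywhere

/-! ### Maximal functions relative to a locally integrable `σ` -/

section MaximalBounds

variable {X : Type*} [MetricSpace X] [MeasurableSpace X] {μ : Measure X} {R : ℝ}

/-- Near `x₀` only the restriction of `σ` to a larger ball matters. It is integrable, so letting the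
height tend to infinity in the weak `(1,1)` bound gives finiteness. -/
theorem IsDoubling.ae_ballMax_lt_top [BorelSpace X] [TopologicalSpace.SeparableSpace X]
    (h : IsDoubling μ) {σ : X → ℝ≥0∞}
    (hσ : ∀ (x : X) (r : ℝ), ∫⁻ y in Metric.ball x r, σ y ∂μ < ∞) (R : ℝ) (x₀ : X) :
    ∀ᵐ x ∂μ, ballMax μ R σ x < ∞ := by
  obtain ⟨A, hA⟩ := h.exists_weak_type
  have hloc : ∀ n : ℕ, ∀ᵐ x ∂μ,
      ballMax μ R ((Metric.ball x₀ (n + 2 * R)).indicator σ) x < ∞ := by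
    intro n
    set B := A * ∫⁻ y in Metric.ball x₀ (n + 2 * R), σ y ∂μ with hB
    have hBt : B < ∞ := ENNReal.mul_lt_top ENNReal.coe_lt_top (hσ _ _)
    have hle : ∀ l : ℝ≥0,
        l * μ {x | ballMax μ R ((Metric.ball x₀ (n + 2 * R)).indicator σ) x = ∞} ≤ B := by
      intro l
      refine le_trans ?_ ((hA R _ l).trans_eq (by rw [lintegral_indicator measurableSet_ball]))
      gcongr with x
      intro hx
      rw [hx]
      exact ENNReal.coe_lt_top
    have : μ {x | ballMax μ R ((Metric.ball x₀ (n + 2 * R)).indicator σ) x = ∞} = 0 := by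
      by_contra h0
      obtain ⟨l, hl⟩ := ENNReal.exists_nat_mul_gt h0 hBt.ne
      exact hl.not_ge (by simpa using hle l)
    rw [ae_iff]
    simpa using this
  filter_upwards [ae_all_iff.2 hloc] with x hx
  obtain ⟨n, hn⟩ := exists_nat_gt (dist x x₀)
  exact (ballMax_le_indicator x₀ (Metric.mem_ball.2 hn)).trans_lt (hx n)

/-- On a set where the maximal function of `σ` is bounded, `G ↦ ballMax (G σ)` is bounded from
`L^p(σ)` into `L^p(μ)`. -/
theorem IsDoubling.exists_lintegral_ballMax_rpow_le [BorelSpace X]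
    [TopologicalSpace.SeparableSpace X] [SFinite μ] (h : IsDoubling μ) {p : ℝ} (hp : 1 < p)
    (R : ℝ) {σ : X → ℝ≥0∞} (hσ : Measurable σ) {M : ℝ≥0} (hM : 0 < M) :
    ∃ K : ℝ≥0, ∀ E : Set X, (∀ᵐ x ∂(μ.restrict E), ballMax μ R σ x ≤ M) →
      ∀ G : X → ℝ≥0, Measurable G →
        ∫⁻ x in E, ballMax μ R (fun y => G y * σ y) x ^ p ∂μ ≤
          K * ∫⁻ y, (G y : ℝ≥0∞) ^ p * σ y ∂μ := by
  obtain ⟨A, hA⟩ := h.exists_weak_type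
  refine ⟨(ENNReal.ofReal p * ((2 * A : ℝ≥0) *
    ENNReal.ofReal ((2 * M : ℝ≥0) ^ (p - 1) / (p - 1)))).toNNReal, fun E hE G hG => ?_⟩
  rw [ENNReal.coe_toNNReal (ENNReal.mul_ne_top ENNReal.ofReal_ne_top
    (ENNReal.mul_ne_top ENNReal.coe_ne_top ENNReal.ofReal_ne_top))]
  have key := lintegral_rpow_le_of_truncated_weak_type (ν := μ.restrict E) (τ := μ.withDensity σ)
    (measurable_ballMax (μ := μ) (R := R) (f := fun y => (G y : ℝ≥0∞) * σ y)) hG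
    (B := 2 * A) (D := 2 * M) hp ?_
  · rw [lintegral_withDensity_eq_lintegral_mul _ hσ
      (hG.coe_nnreal_ennreal.pow_const p)] at key
    simpa only [Pi.mul_apply, mul_comm (σ _)] using key
  intro l hl
  set S : Set X := {y | l < 2 * M * G y} with hS
  have hSm : MeasurableSet S := measurableSet_lt measurable_const (hG.const_mul _)
  set f₁ : X → ℝ≥0∞ := S.indicator fun y => G y * σ y with hf₁
  -- Off `S` one has `G ≤ c`, and on `E` the maximal function of `c σ` is at most `c M = l / 2`.
  -- This plays the role of the `L^∞` endpoint; only `f₁` meets the weak type bound.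
  set c : ℝ≥0 := l / (2 * M) with hc
  have hf₁m : Measurable f₁ := (hG.coe_nnreal_ennreal.mul hσ).indicator hSm
  have hsplit : ∀ y, (G y : ℝ≥0∞) * σ y ≤ f₁ y + c * σ y := by
    intro y
    by_cases hy : y ∈ S
    · rw [hf₁, indicator_of_mem hy]
      exact le_self_add
    · rw [hf₁, indicator_of_notMem hy, zero_add]
      gcongr
      rw [hc, le_div_iff₀ (by positivity), mul_comm]
      exact not_lt.1 hy
  have hle : (μ.restrict E) {x | l < ballMax μ R (fun y => (G y : ℝ≥0∞) * σ y) x} ≤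
      μ {x | ((l / 2 : ℝ≥0) : ℝ≥0∞) < ballMax μ R f₁ x} := by
    refine le_trans (measure_mono_ae ?_) (Measure.restrict_apply_le E _)
    filter_upwards [hE] with x hx hlx
    have hlx : (l : ℝ≥0∞) < ballMax μ R (fun y => (G y : ℝ≥0∞) * σ y) x := hlx
    change ((l / 2 : ℝ≥0) : ℝ≥0∞) < ballMax μ R f₁ x
    by_contra hcon
    refine hlx.not_ge ?_
    calc ballMax μ R (fun y => (G y : ℝ≥0∞) * σ y) x
        ≤ ballMax μ R (fun y => f₁ y + c * σ y) x :=
          ballMax_mono_ae (Eventually.of_forall hsplit) x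
      _ ≤ ballMax μ R f₁ x + ballMax μ R (fun y => c * σ y) x :=
          ballMax_add_le hf₁m.aemeasurable x
      _ ≤ (l / 2 : ℝ≥0) + c * M := by
          refine add_le_add (not_lt.1 hcon) ((ballMax_const_mul_le ENNReal.coe_ne_top x).trans ?_)
          gcongr
      _ = l := by
          rw [← ENNReal.coe_mul, ← ENNReal.coe_add, hc]
          congr 1
          field_simp
          norm_num
  calc (l : ℝ≥0∞) * (μ.restrict E) {x | l < ballMax μ R (fun y => (G y : ℝ≥0∞) * σ y) x}
      ≤ l * μ {x | ((l / 2 : ℝ≥0) : ℝ≥0∞) < ballMax μ R f₁ x} := by gcongr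
    _ = 2 * ((l / 2 : ℝ≥0) * μ {x | ((l / 2 : ℝ≥0) : ℝ≥0∞) < ballMax μ R f₁ x}) := by
        rw [← mul_assoc]
        congr 1
        rw [← ENNReal.coe_ofNat, ← ENNReal.coe_mul]
        congr 1
        field_simp
    _ ≤ 2 * (A * ∫⁻ y, f₁ y ∂μ) := mul_le_mul' le_rfl (hA _ _ _)
    _ = (2 * A : ℝ≥0) * ∫⁻ y in S, G y ∂(μ.withDensity σ) := by
        rw [hf₁, lintegral_indicator hSm, restrict_withDensity hSm,
          lintegral_withDensity_eq_lintegral_mul _ hσ hG.coe_nnreal_ennreal]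
        push_cast
        rw [mul_assoc]
        simp only [Pi.mul_apply, mul_comm (σ _)]

end MaximalBounds

/-! ### Constructing `u` from `D_p` -/

section Construction

variable {X : Type*} [MetricSpace X] [MeasurableSpace X] {μ : Measure X}
  {T : ℝ≥0∞} {φ : ℝ → X → X → ℝ≥0} {t R p : ℝ} {v : X → ℝ}

/-- The Harnack comparison spreads the finiteness in `D_p` to all base points. -/
theorem InD.exists_forall (hφ : IsHeatKernel μ T φ) (hA : KernelAssumption μ T φ)
    (hv : IsWeight μ v) (h : InD μ T φ p v) :
    ∃ t, IsTime T t ∧ ∀ x, MemLp (fun y => v y ^ (-(1 / p)) * (φ t x y : ℝ))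
      (ENNReal.conjExponent (ENNReal.ofReal p)) μ := by
  obtain ⟨t₀, ht₀, x₀, hx₀⟩ := h
  obtain ⟨η, hη0, hη1, hη⟩ := hA.harnack
  have ht : IsTime T (η * t₀) :=
    ht₀.mono (mul_pos hη0 ht₀.1) (mul_le_of_le_one_left ht₀.1.le hη1)
  have hm : ∀ s, IsTime T s → ∀ x, Measurable fun y => v y ^ (-(1 / p)) * (φ s x y : ℝ) :=
    fun s hs x => (hv.measurable.pow_const _).mul (hφ.measurable_right hs x).coe_nnreal_real
  refine ⟨η * t₀, ht, fun x => ?_⟩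
  obtain ⟨C, hC⟩ := hη t₀ ht₀ x x₀
  have hx₀' : MemLp (fun y => v y ^ (-(1 / p)) * (φ t₀ x₀ y : ℝ))
    (ENNReal.conjExponent (ENNReal.ofReal p)) μ := ⟨(hm _ ht₀ x₀).aestronglyMeasurable, hx₀⟩
  refine hx₀'.of_le_mul (c := C) (hm _ ht x).aestronglyMeasurable (Eventually.of_forall fun y => ?_)
  have hvy := Real.rpow_nonneg (hv.pos y).le (-(1 / p))
  rw [norm_mul, norm_mul, mul_left_comm]
  gcongr
  rw [Real.norm_of_nonneg (NNReal.coe_nonneg _), Real.norm_of_nonneg (NNReal.coe_nonneg _)]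
  exact_mod_cast hC y

variable [BorelSpace X]

theorem memLp_indicator_ball [LocallyCompactSpace X] [IsFiniteMeasureOnCompacts μ]
    (hμ : IsDoubling μ) (h0 : μ ≠ 0) {w : X → ℝ} (hw : Measurable w) {q : ℝ≥0∞} {ρ : ℝ}
    (hρ : 0 < ρ) (h : ∀ x, MemLp ((Metric.ball x ρ).indicator w) q μ) (x : X) (r : ℝ) :
    MemLp ((Metric.ball x r).indicator w) q μ := by
  obtain ⟨F, hF, hsub⟩ := hμ.exists_finite_cover h0 x r hρ
  refine (memLp_finsetSum hF.toFinset fun y _ => (h y).norm).mono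
    (hw.indicator measurableSet_ball).aestronglyMeasurable (Eventually.of_forall fun y => ?_)
  rw [Real.norm_of_nonneg (Finset.sum_nonneg fun _ _ => norm_nonneg _)]
  by_cases hy : y ∈ Metric.ball x r
  · obtain ⟨z, hz, hyz⟩ := mem_iUnion₂.1 (hsub hy)
    refine le_trans ?_ (Finset.single_le_sum (f := fun z => ‖(Metric.ball z ρ).indicator w y‖)
      (fun _ _ => norm_nonneg _) (hF.mem_toFinset.2 hz))
    simp only [indicator_of_mem hy, indicator_of_mem hyz, le_refl]
  · rw [indicator_of_notMem hy, norm_zero]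
    exact Finset.sum_nonneg fun _ _ => norm_nonneg _

/-- On `B(x, t)` the kernel is bounded below, so `v^{-1/p}` is dominated there by a multiple of
`v^{-1/p} φ_t(x, ·)`. Finite covers by balls of radius `t` give arbitrary balls. -/
theorem memLp_indicator_ball_rpow [LocallyCompactSpace X] [IsFiniteMeasureOnCompacts μ]
    (hμ : IsDoubling μ) (h0 : μ ≠ 0) (hA : KernelAssumption μ T φ)
    (hv : IsWeight μ v) (ht : IsTime T t) {q : ℝ≥0∞}
    (h : ∀ x, MemLp (fun y => v y ^ (-(1 / p)) * (φ t x y : ℝ)) q μ) (x : X) (r : ℝ) :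
    MemLp ((Metric.ball x r).indicator fun y => v y ^ (-(1 / p))) q μ := by
  have hw : Measurable fun y => v y ^ (-(1 / p)) := hv.measurable.pow_const _
  refine memLp_indicator_ball hμ h0 hw ht.1 (fun x => ?_) x r
  obtain ⟨C, hC0, hC⟩ := hA.lower t ht x
  refine (h x).of_le_mul (c := (C⁻¹ : ℝ≥0)) (hw.indicator measurableSet_ball).aestronglyMeasurable
    (Eventually.of_forall fun y => ?_)
  by_cases hy : y ∈ Metric.ball x t
  · have h1 : 1 ≤ C⁻¹ * φ t x y := by
      rw [inv_mul_eq_div, one_le_div hC0]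
      exact hC y hy
    have h1' : (1 : ℝ) ≤ (C⁻¹ : ℝ≥0) * (φ t x y : ℝ) := by exact_mod_cast h1
    rw [indicator_of_mem hy, norm_mul, Real.norm_of_nonneg (NNReal.coe_nonneg (φ t x y)),
      mul_left_comm]
    exact le_mul_of_one_le_right (norm_nonneg _) h1'
  · rw [indicator_of_notMem hy, norm_zero]
    positivity

/-- A sum of integer parts dominates each of them. An infinite value contributes `0` through
`toReal`, hence the finiteness premises. -/
theorem exists_measurable_level (x₀ : X) {H₁ H₂ : X → ℝ≥0∞} (h₁ : Measurable H₁)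
    (h₂ : Measurable H₂) : ∃ N : X → ℕ, Measurable N ∧ (∀ x, dist x x₀ < N x + 1) ∧
      (∀ x, H₁ x < ∞ → H₁ x ≤ (N x + 1 : ℝ≥0)) ∧ ∀ x, H₂ x < ∞ → H₂ x ≤ (N x + 1 : ℝ≥0) := by
  have hle : ∀ (a : ℝ≥0∞) (n : ℕ), a < ∞ → ⌊a.toReal⌋₊ ≤ n → a ≤ (n + 1 : ℝ≥0) := by
    intro a n ha hn
    rw [← ENNReal.ofReal_toReal ha.ne, ENNReal.ofReal, ENNReal.coe_le_coe,
      Real.toNNReal_le_iff_le_coe]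
    push_cast
    have : (⌊a.toReal⌋₊ : ℝ) ≤ n := by exact_mod_cast hn
    linarith [Nat.lt_floor_add_one a.toReal]
  refine ⟨fun x => ⌊dist x x₀⌋₊ + (⌊(H₁ x).toReal⌋₊ + ⌊(H₂ x).toReal⌋₊), ?_, fun x => ?_,
    fun x hx => hle _ _ hx (by dsimp only; omega), fun x hx => hle _ _ hx (by dsimp only; omega)⟩
  · exact (Nat.measurable_floor.comp (continuous_id.dist continuous_const).measurable).add
      ((Nat.measurable_floor.comp h₁.ennreal_toReal).add
        (Nat.measurable_floor.comp h₂.ennreal_toReal))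
  · have := Nat.lt_floor_add_one (dist x x₀)
    push_cast
    linarith [Nat.cast_nonneg (α := ℝ) ⌊(H₁ x).toReal⌋₊, Nat.cast_nonneg (α := ℝ) ⌊(H₂ x).toReal⌋₊]

/-- The maximal operator is controlled by the local maximal function and the norm in `L^p_v`, with
constants depending only on a measurable level. -/
theorem exists_level_bound_timeMax [SFinite μ] (hφ : IsHeatKernel μ T φ)
    (hA : KernelAssumption μ T φ) (hp : 1 ≤ p) (hv : IsWeight μ v) (ht : IsTime T t)
    (h : ∀ x, MemLp (fun y => v y ^ (-(1 / p)) * (φ t x y : ℝ))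
      (ENNReal.conjExponent (ENNReal.ofReal p)) μ) (x₀ : X) :
    ∃ R, IsTime T R ∧ ∃ Γ : ℝ, ∀ H : X → ℝ≥0∞, Measurable H →
      ∃ N : X → ℕ, Measurable N ∧ (∀ x, dist x x₀ < N x + 1) ∧
        (∀ x, H x < ∞ → H x ≤ (N x + 1 : ℝ≥0)) ∧ ∃ a b : ℕ → ℝ≥0,
          ∀ f : X → ℝ, MemLp f (ENNReal.ofReal p) (weighted μ v) → ∀ x,
            timeMax μ φ R f x ≤ a (N x) * ballMax μ Γ (fun y => ‖f y‖ₑ) x +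
              b (N x) * eLpNorm f (ENNReal.ofReal p) (weighted μ v) := by
  obtain ⟨γ, ξ₁, ξ₂, Γ, hγ, hξ₁, hξ₂, -, hmax⟩ := hA.maximal
  have hγ0 : 0 < γ := by linarith
  have hRt : γ * (t / γ) = t := mul_div_cancel₀ t hγ0.ne'
  have hR0 : 0 < t / γ := div_pos ht.1 hγ0
  have hR : IsTime T (t / γ) := ht.mono hR0 (div_le_self ht.1.le hγ)
  -- With `R = t / γ` the kernel integral in the maximal inequality is taken at time `t`. The radius
  -- is fixed before `H`, because `H` will later be a maximal function of that radius.
  refine ⟨t / γ, hR, Γ (t / γ), fun H hH => ?_⟩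
  have hk : Measurable (Function.uncurry fun x y => v y ^ (-(1 / p)) * (φ t x y : ℝ)) :=
    ((hv.measurable.pow_const _).comp measurable_snd).mul (hφ.measurable t ht).coe_nnreal_real
  obtain ⟨N, hN, hdist, hH₁, hH₂⟩ := exists_measurable_level x₀
    (measurable_eLpNorm_conjExponent (μ := μ) hp hk) hH
  choose M₁ hM₁ using fun n : ℕ => (hξ₁ (t / γ) hR0).2 (Metric.ball x₀ (n + 1)) Metric.isBounded_ball
  choose M₂ hM₂ using fun n : ℕ => (hξ₂ (t / γ) hR0).2 (Metric.ball x₀ (n + 1)) Metric.isBounded_ball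
  refine ⟨N, hN, hdist, hH₂, fun n => (M₁ n).toNNReal, fun n => (M₂ n).toNNReal * (n + 1),
    fun f hf x => ?_⟩
  have hfm := hv.aestronglyMeasurable hf.1
  refine (hφ.timeMax_le_of_forall hR
    (fun f hf hf0 => hmax (t / γ) (by rwa [hRt]) f hf hf0 x) hfm).trans ?_
  rw [hRt]
  have hx : x ∈ Metric.ball x₀ (N x + 1) := hdist x
  gcongr ?_ * _ + ?_
  · exact ENNReal.ofReal_le_ofReal (hM₁ _ x hx)
  · push_cast
    rw [mul_assoc]
    refine mul_le_mul' (ENNReal.ofReal_le_ofReal (hM₂ _ x hx)) ?_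
    have hκ : Measurable fun y => (φ t x y : ℝ) := (hφ.measurable_right ht x).coe_nnreal_real
    refine le_trans (le_of_eq ?_) ((hv.lintegral_mul_le hp hκ.aestronglyMeasurable hfm).trans
      (mul_le_mul' ?_ le_rfl))
    · simp
    · simpa using hH₁ x (h x).2

theorem exists_weakBounded [LocallyCompactSpace X] [TopologicalSpace.SeparableSpace X]
    [IsFiniteMeasureOnCompacts μ] [SFinite μ] [Nonempty X] (hμ : IsDoubling μ)
    (h0 : μ ≠ 0) (hφ : IsHeatKernel μ T φ) (hA : KernelAssumption μ T φ) (hv : IsWeight μ v)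
    (hD : InD μ T φ 1 v) :
    ∃ R, IsTime T R ∧ ∃ u : X → ℝ, IsWeight μ u ∧ WeakBounded μ φ R v u := by
  obtain ⟨x₀⟩ := ‹Nonempty X›
  obtain ⟨t, ht, hmem⟩ := hD.exists_forall hφ hA hv
  obtain ⟨R, hR, Γ, hΓ⟩ := exists_level_bound_timeMax hφ hA le_rfl hv ht hmem x₀
  obtain ⟨N, hN, hdist, -, a, b, hab⟩ := hΓ 0 measurable_zero
  obtain ⟨A, hA'⟩ := hμ.exists_weak_type
  have hloc := memLp_indicator_ball_rpow hμ h0 hA hv ht hmem x₀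
  set m : ℕ → ℝ≥0 := fun n => (eLpNorm ((Metric.ball x₀ (n + 1 + 2 * Γ)).indicator
    fun y => v y ^ (-(1 / 1 : ℝ))) (ENNReal.conjExponent (ENNReal.ofReal 1)) μ).toNNReal with hm
  -- The first summand comes from weak type `(1,1)` applied to `f` cut off to a ball. The second
  -- comes from the term that is constant on the level, whose superlevel set is empty or lies in a
  -- ball of finite measure.
  set K : ℕ → ℝ≥0 := fun n => 2 * (a n + 1) * A * m n +
    2 * b n * (μ (Metric.ball x₀ (n + 1))).toNNReal with hK
  refine ⟨R, hR, levelWeight N K, isWeight_levelWeight hN K, 1, fun f hf l hl => ?_⟩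
  have hfm := hv.aestronglyMeasurable hf.1
  set Φ := eLpNorm f (ENNReal.ofReal 1) (weighted μ v) with hΦ
  set J : X → ℝ≥0∞ := fun x => a (N x) * ballMax μ Γ (fun y => ‖f y‖ₑ) x + b (N x) * Φ with hJ
  have hJm : Measurable J :=
    (((measurable_from_nat (f := fun n => (a n : ℝ≥0∞))).comp hN).mul measurable_ballMax).add
      (((measurable_from_nat (f := fun n => (b n : ℝ≥0∞))).comp hN).mul measurable_const)
  have hSm : MeasurableSet {x | (l : ℝ≥0∞) < J x} := measurableSet_lt measurable_const hJm
  have key := lintegral_levelWeight_le (μ := μ) hN (K := K) (a := Φ)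
    (F := {x | (l : ℝ≥0∞) < J x}.indicator fun _ => (l : ℝ≥0∞)) fun n => ?_
  · rw [lintegral_indicator_const hSm] at key
    refine le_trans ?_ (key.trans_eq (by rw [hΦ, ENNReal.ofReal_one]; simp))
    exact mul_le_mul' le_rfl (measure_mono fun x hx =>
      lt_of_lt_of_le (show (l : ℝ≥0∞) < timeMax μ φ R f x from hx) (hab f (by simpa using hf) x))
  have hAn : N ⁻¹' {n} ⊆ Metric.ball x₀ (n + 1) := fun x hx => by
    have hx : N x = n := hx
    simpa [hx] using hdist x
  set B := Metric.ball x₀ (n + 1 + 2 * Γ) with hB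
  set f₁ : X → ℝ≥0∞ := B.indicator fun y => ‖f y‖ₑ with hf₁
  have hf₁le : ∫⁻ y, f₁ y ∂μ ≤ m n * Φ := by
    have := hv.lintegral_mul_le le_rfl (κ := B.indicator 1)
      (measurable_one.indicator measurableSet_ball).aestronglyMeasurable hfm
    refine le_trans (le_of_eq ?_) (this.trans_eq ?_)
    · refine lintegral_congr fun y => ?_
      by_cases hy : y ∈ B <;> simp [hf₁, hy]
    · congr 1
      rw [hm, ENNReal.coe_toNNReal (hloc _).2.ne]
      congr 1
      ext y
      by_cases hy : y ∈ B
      · simp [← hB, hy]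
      · simp [← hB, hy]
  -- The `+ 1` guards against `a n = 0`.
  set c : ℝ≥0 := l / (2 * (a n + 1)) with hc
  rw [lintegral_indicator_const hSm, Measure.restrict_apply hSm]
  have hsub : {x | (l : ℝ≥0∞) < J x} ∩ N ⁻¹' {n} ⊆
      {x | (c : ℝ≥0∞) < ballMax μ Γ f₁ x} ∪
        {x ∈ Metric.ball x₀ (n + 1) | (l : ℝ≥0∞) < 2 * (b n * Φ)} := by
    rintro x ⟨hx, hxn⟩
    have hxN : N x = n := hxn
    by_contra hcon
    simp only [mem_union, mem_ofPred_eq, not_or, not_and, not_lt] at hcon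
    have h2 := hcon.2 (hAn hxn)
    have hx : (l : ℝ≥0∞) < J x := hx
    refine hx.not_ge ?_
    have hbm : ballMax μ Γ (fun y => ‖f y‖ₑ) x ≤ c :=
      (ballMax_le_indicator x₀ (hAn hxn)).trans hcon.1
    have hb2 : (b n : ℝ≥0∞) * Φ ≤ ((l / 2 : ℝ≥0) : ℝ≥0∞) := by
      rw [ENNReal.coe_div two_ne_zero, ENNReal.le_div_iff_mul_le (by simp) (by simp), mul_comm]
      exact h2
    calc J x ≤ (a n + 1 : ℝ≥0) * c + (l / 2 : ℝ≥0) := by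
          simp only [hJ, hxN]
          gcongr
          simp
      _ = l := by
          rw [← ENNReal.coe_mul, ← ENNReal.coe_add, hc]
          congr 1
          field_simp
          norm_num
  calc (l : ℝ≥0∞) * μ ({x | (l : ℝ≥0∞) < J x} ∩ N ⁻¹' {n})
      ≤ l * (μ {x | (c : ℝ≥0∞) < ballMax μ Γ f₁ x} +
          μ {x ∈ Metric.ball x₀ (n + 1) | (l : ℝ≥0∞) < 2 * (b n * Φ)}) := by
        gcongr
        exact (measure_mono hsub).trans (measure_union_le _ _)
    _ = (2 * (a n + 1) : ℝ≥0) * (c * μ {x | (c : ℝ≥0∞) < ballMax μ Γ f₁ x}) +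
          l * μ {x ∈ Metric.ball x₀ (n + 1) | (l : ℝ≥0∞) < 2 * (b n * Φ)} := by
        rw [mul_add, ← mul_assoc ((2 * (a n + 1) : ℝ≥0) : ℝ≥0∞), ← ENNReal.coe_mul, hc, mul_div_cancel₀ _ (by positivity)]
    _ ≤ (2 * (a n + 1) : ℝ≥0) * (A * (m n * Φ)) +
          2 * (b n * Φ) * μ (Metric.ball x₀ (n + 1)) := by
        refine add_le_add (mul_le_mul' le_rfl ((hA' _ _ _).trans (by gcongr))) ?_
        · by_cases hl2 : (l : ℝ≥0∞) < 2 * (b n * Φ)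
          · exact mul_le_mul' hl2.le (measure_mono fun x hx => hx.1)
          · simp [hl2]
    _ = K n * Φ := by
        rw [hK]
        push_cast
        rw [ENNReal.coe_toNNReal (hμ.ball_lt_top _ _).ne]
        ring

theorem exists_strongBounded [LocallyCompactSpace X] [TopologicalSpace.SeparableSpace X]
    [IsFiniteMeasureOnCompacts μ] [SFinite μ] [Nonempty X] (hμ : IsDoubling μ)
    (h0 : μ ≠ 0) (hφ : IsHeatKernel μ T φ) (hA : KernelAssumption μ T φ) (hp : 1 < p)
    (hv : IsWeight μ v) (hD : InD μ T φ p v) :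
    ∃ R, IsTime T R ∧ ∃ u : X → ℝ, IsWeight μ u ∧ StrongBounded μ φ p R v u := by
  obtain ⟨x₀⟩ := ‹Nonempty X›
  have hp0 : 0 < p := by linarith
  have hpq := Real.HolderConjugate.conjExponent hp
  obtain ⟨t, ht, hmem⟩ := hD.exists_forall hφ hA hv
  obtain ⟨R, hR, Γ, hΓ⟩ := exists_level_bound_timeMax hφ hA hp.le hv ht hmem x₀
  -- This exponent makes `σ = v^{-s}` the `p'`-th power of `v^{-1/p}`, and satisfies `s p - s = 1`.
  set s := 1 / (p - 1) with hs
  have hs' : -(1 / p) * p.conjExponent = -s := by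
    have : p - 1 ≠ 0 := by linarith
    rw [hs, Real.conjExponent]
    field_simp
  set σ : X → ℝ≥0∞ := fun y => ENNReal.ofReal (v y ^ (-s)) with hσ
  have hσm : Measurable σ := (hv.measurable.pow_const _).ennreal_ofReal
  have hσloc : ∀ (x : X) (r : ℝ), ∫⁻ y in Metric.ball x r, σ y ∂μ < ∞ := by
    intro x r
    have := (memLp_indicator_ball_rpow hμ h0 hA hv ht hmem x r).2
    rw [← eLpNorm_enorm, eLpNorm_conjExponent_eq hp,
      ENNReal.rpow_lt_top_iff_of_pos (one_div_pos.2 hpq.symm.pos)] at this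
    rw [← lintegral_indicator measurableSet_ball]
    refine (lintegral_mono fun y => ?_).trans_lt this
    by_cases hy : y ∈ Metric.ball x r
    · rw [indicator_of_mem hy, indicator_of_mem hy, hσ,
        Real.enorm_of_nonneg (Real.rpow_nonneg (hv.pos y).le _),
        ENNReal.ofReal_rpow_of_nonneg (Real.rpow_nonneg (hv.pos y).le _) hpq.symm.nonneg,
        ← Real.rpow_mul (hv.pos y).le, hs']
    · rw [indicator_of_notMem hy]
      exact zero_le
  have hfin := hμ.ae_ballMax_lt_top hσloc Γ x₀
  -- Recording the maximal function of `σ` in the level bounds it by `n + 1` almost everywhere on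
  -- level `n`.
  obtain ⟨N, hN, hdist, hNσ, a, b, hab⟩ := hΓ (ballMax μ Γ σ) measurable_ballMax
  choose L hL using fun n : ℕ => hμ.exists_lintegral_ballMax_rpow_le hp Γ hσm
    (M := n + 1) (by positivity)
  set K : ℕ → ℝ≥0 := fun n => 2 ^ (p - 1) * (a n ^ p * L n +
    b n ^ p * (μ (Metric.ball x₀ (n + 1))).toNNReal) with hK
  refine ⟨R, hR, levelWeight N K, isWeight_levelWeight hN K, 1, fun f hf => ?_⟩
  have hfm := hv.aestronglyMeasurable hf.1
  set Φ := eLpNorm f (ENNReal.ofReal p) (weighted μ v) with hΦ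
  set J : X → ℝ≥0∞ := fun x => a (N x) * ballMax μ Γ (fun y => ‖f y‖ₑ) x + b (N x) * Φ with hJ
  have hJm : Measurable J :=
    (((measurable_from_nat (f := fun n => (a n : ℝ≥0∞))).comp hN).mul measurable_ballMax).add
      (((measurable_from_nat (f := fun n => (b n : ℝ≥0∞))).comp hN).mul measurable_const)
  refine (iInf_le_of_le J (iInf₂_le_of_le hJm (hab f hf) le_rfl)).trans ?_
  rw [ENNReal.coe_one, one_mul, eLpNorm_eq_lintegral_rpow_enorm_toReal
    (ENNReal.ofReal_pos.2 hp0).ne' ENNReal.ofReal_ne_top, ENNReal.toReal_ofReal hp0.le, one_div,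
    ENNReal.rpow_inv_le_iff hp0]
  refine lintegral_levelWeight_le hN fun n => ?_
  have hAn : N ⁻¹' {n} ⊆ Metric.ball x₀ (n + 1) := fun x hx => by
    have hx : N x = n := hx
    simpa [hx] using hdist x
  have hAm : MeasurableSet (N ⁻¹' {n}) := hN (measurableSet_singleton n)
  -- Almost everywhere `|f| = G σ` and `G^p σ = |f|^p v`, so the `L^p(σ)` norm of `G` is the `L^p_v`
  -- norm of `f`.
  set G : X → ℝ≥0 := fun y => ‖hfm.mk f y‖₊ * (v y ^ s).toNNReal with hG
  have hGm : Measurable G := hfm.stronglyMeasurable_mk.measurable.nnnorm.mul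
    (hv.measurable.pow_const _).real_toNNReal
  have hGσ : ∀ᵐ y ∂μ, ‖f y‖ₑ = G y * σ y := hfm.ae_eq_mk.mono fun y hy => by
    rw [hG, hσ, ENNReal.coe_mul, mul_assoc, ← hy]
    change _ = _ * (ENNReal.ofReal _ * _)
    rw [← ENNReal.ofReal_mul (Real.rpow_nonneg (hv.pos y).le _), ← Real.rpow_add (hv.pos y)]
    simp [enorm_eq_nnnorm]
  have hGp : ∫⁻ y, (G y : ℝ≥0∞) ^ p * σ y ∂μ = Φ ^ p := by
    rw [hΦ, eLpNorm_weighted_rpow hv.measurable hp0]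
    refine lintegral_congr_ae (hfm.ae_eq_mk.mono fun y hy => ?_)
    have hvy := hv.pos y
    simp only [hG, hσ]
    rw [ENNReal.coe_mul, ENNReal.mul_rpow_of_nonneg _ _ hp0.le, ← hy, mul_assoc,
      mul_comm (ENNReal.ofReal (v y))]
    change _ * ((ENNReal.ofReal _) ^ p * _) = _
    rw [ENNReal.ofReal_rpow_of_nonneg (Real.rpow_nonneg hvy.le _) hp0.le, ← Real.rpow_mul hvy.le,
      ← ENNReal.ofReal_mul (Real.rpow_nonneg hvy.le _), ← Real.rpow_add hvy]
    have : s * p + -s = 1 := by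
      have : p - 1 ≠ 0 := by linarith
      rw [hs]; field_simp; ring
    rw [this, Real.rpow_one, enorm_eq_nnnorm]
  have hball : ∫⁻ x in N ⁻¹' {n}, ballMax μ Γ (fun y => ‖f y‖ₑ) x ^ p ∂μ ≤ L n * Φ ^ p := by
    rw [← hGp]
    refine (lintegral_mono fun x => ENNReal.rpow_le_rpow
      (ballMax_mono_ae (hGσ.mono fun y hy => hy.le) x) hp0.le).trans (hL n _ ?_ G hGm)
    filter_upwards [ae_restrict_of_ae hfin, ae_restrict_mem hAm] with x hx hxn
    have hxn : N x = n := hxn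
    simpa [hxn] using hNσ x hx
  calc ∫⁻ x in N ⁻¹' {n}, ‖J x‖ₑ ^ p ∂μ
      ≤ ∫⁻ x in N ⁻¹' {n}, (2 : ℝ≥0∞) ^ (p - 1) *
          ((a n : ℝ≥0∞) ^ p * ballMax μ Γ (fun y => ‖f y‖ₑ) x ^ p + (b n * Φ) ^ p) ∂μ := by
        refine setLIntegral_mono' hAm fun x hx => ?_
        have hx : N x = n := hx
        simp only [hJ, enorm_eq_self, hx]
        refine (ENNReal.rpow_add_le_mul_rpow_add_rpow _ _ hp.le).trans_eq ?_
        rw [ENNReal.mul_rpow_of_nonneg _ (ballMax _ _ _ _) hp0.le]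
    _ = (2 : ℝ≥0∞) ^ (p - 1) * ((a n : ℝ≥0∞) ^ p *
          ∫⁻ x in N ⁻¹' {n}, ballMax μ Γ (fun y => ‖f y‖ₑ) x ^ p ∂μ +
            (b n * Φ) ^ p * μ (N ⁻¹' {n})) := by
        rw [lintegral_const_mul _ (((measurable_ballMax.pow_const p).const_mul _).add_const _),
          lintegral_add_right _ measurable_const,
          lintegral_const_mul _ (measurable_ballMax.pow_const p), setLIntegral_const]
    _ ≤ (2 : ℝ≥0∞) ^ (p - 1) * ((a n : ℝ≥0∞) ^ p * (L n * Φ ^ p) +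
            (b n ^ p * Φ ^ p) * μ (Metric.ball x₀ (n + 1))) := by
        rw [ENNReal.mul_rpow_of_nonneg _ _ hp0.le]
        gcongr
    _ = K n * Φ ^ p := by
        have h2 : ((2 ^ (p - 1) : ℝ≥0) : ℝ≥0∞) = 2 ^ (p - 1) := by
          rw [ENNReal.coe_rpow_of_nonneg _ (by linarith)]
          rfl
        rw [hK]
        push_cast
        rw [h2, ENNReal.coe_toNNReal (hμ.ball_lt_top _ _).ne, ← ENNReal.coe_rpow_of_nonneg _ hp0.le,
          ← ENNReal.coe_rpow_of_nonneg _ hp0.le]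
        ring

end Construction

end HeatKernel

end

/-! ### The equivalence -/

theorem theorem1p3 {X : Type*} [MetricSpace X] [Nonempty X] [LocallyCompactSpace X]
    [TopologicalSpace.SeparableSpace X] [MeasurableSpace X] [BorelSpace X]
    (μ : Measure X) [μ.Regular] (hμ : HeatKernel.IsDoubling μ)
    (T : ℝ≥0∞) (hT : 0 < T) (φ : ℝ → X → X → ℝ≥0)
    (hφ : HeatKernel.IsHeatKernel μ T φ) (hA : HeatKernel.KernelAssumption μ T φ)
    (p : ℝ) (hp : 1 ≤ p) (v : X → ℝ) (hv : HeatKernel.IsWeight μ v) :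
    List.TFAE [
      ∃ R, HeatKernel.IsTime T R ∧ ∃ u : X → ℝ, HeatKernel.IsWeight μ u ∧
        (1 < p → HeatKernel.StrongBounded μ φ p R v u) ∧
        (p = 1 → HeatKernel.WeakBounded μ φ R v u),
      ∃ R, HeatKernel.IsTime T R ∧
        ∀ f : X → ℝ, MemLp f (ENNReal.ofReal p) (HeatKernel.weighted μ v) →
          (∀ x, HeatKernel.Converges μ φ R f x) ∧
          ∀ᵐ x ∂μ, (∀ᶠ t in 𝓝[>] (0 : ℝ), HeatKernel.Converges μ φ t f x) ∧
            Tendsto (fun t => HeatKernel.S μ φ t f x) (𝓝[>] 0) (𝓝 (f x)),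
      ∃ R, HeatKernel.IsTime T R ∧
        ∀ f : X → ℝ, MemLp f (ENNReal.ofReal p) (HeatKernel.weighted μ v) →
          ∃ x, HeatKernel.Converges μ φ R f x,
      HeatKernel.InD μ T φ p v] := by
  have : SecondCountableTopology X := UniformSpace.secondCountable_of_separable X
  have h0 := hφ.measure_ne_zero hT
  tfae_have 1 → 2 := by
    rintro ⟨R, hR, u, hu, hs, hw⟩
    obtain ⟨η, hη0, hη1, hη⟩ := hA.harnack
    -- The maximal operator controls only times strictly below `R`, so Harnack is applied from `R /
    -- 2`.
    have hR2 : HeatKernel.IsTime T (R / 2) := hR.mono (half_pos hR.1) (half_le_self hR.1.le)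
    have hηR : HeatKernel.IsTime T (η * (R / 2)) :=
      hR2.mono (mul_pos hη0 hR2.1) (mul_le_of_le_one_left hR2.1.le hη1)
    refine ⟨η * (R / 2), hηR, fun f hf => ?_⟩
    have hae := HeatKernel.ae_tendsto_of_bounded hφ hA hp hv hu hR hs hw hf
    have hfm := hv.aestronglyMeasurable hf.1
    refine ⟨fun x => ?_, hae.mono fun x hx => ⟨?_, hx.2⟩⟩
    · have : (ae μ).NeBot := ae_neBot.2 h0
      obtain ⟨y, hy⟩ := hae.exists
      have hy := hy.1 (R / 2) ⟨hR2.1, half_lt_self hR.1⟩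
      exact hφ.converges_of_harnack hR2 hηR (hη _ hR2 x y) hfm hy
    · filter_upwards [Ioo_mem_nhdsGT hR.1] with t ht using hx.1 t ht
  tfae_have 2 → 3 := by
    rintro ⟨R, hR, h⟩
    obtain ⟨x⟩ := ‹Nonempty X›
    exact ⟨R, hR, fun f hf => ⟨x, (h f hf).1 x⟩⟩
  tfae_have 3 → 4 := fun ⟨R, hR, h⟩ =>
    HeatKernel.inD_of_forall_exists_converges hφ hA hp hv hR h
  tfae_have 4 → 1 := by
    intro hD
    rcases hp.eq_or_lt with rfl | hp1
    · obtain ⟨R, hR, u, hu, h⟩ := HeatKernel.exists_weakBounded hμ h0 hφ hA hv hD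
      exact ⟨R, hR, u, hu, fun h1 => absurd h1 (lt_irrefl _), fun _ => h⟩
    · obtain ⟨R, hR, u, hu, h⟩ := HeatKernel.exists_strongBounded hμ h0 hφ hA hp1 hv hD
      exact ⟨R, hR, u, hu, fun _ => h, fun h1 => absurd h1 hp1.ne'⟩
  tfae_finish
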